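/- Let $\alpha>0$ and $R>0$. Let $\mathbb H$ be the quaternions, $\mathbb S=\{I\in\mathbb H: I^2=-1\}$, $\mathbb B_R=\{q\in\mathbb H:|q|<R\}$. Let $L^{2,\alpha}(\mathbb R^+,\mathbb H)$ be the right quaternionic Hilbert space of (classes of) functions $\varphi:\mathbb R^+\to\mathbb H$ that are square integrable for $\frac{t^{\alpha}e^{-t}}{\Gamma(\alpha+1)}\,dt$, with scalar product $\langle\varphi,\psi\rangle=\int_0^\infty\overline{\varphi(t)}\,\psi(t)\,\frac{t^{\alpha}e^{-t}}{\Gamma(\alpha+1)}\,dt$. A function $f:\mathbb B_R\to\mathbb H$ is (left) slice regular if it is real differentiable and, for every $I\in\mathbb S$, the function $(x,y)\mapsto f(x+Iy)$ is continuously differentiable on the disc $x^2+y^2<R^2$ and satisfies $\frac12\left(\frac{\partial}{\partial x}+I\frac{\partial}{\partial y}\right)f(x+Iy)=0$ there. For $I\in\mathbb S$ let $A^{2,\alpha}_{slice}(\mathbb B_R)$ be the right $\mathbb H$-vector space of slice regular functions $f$ on $\mathbb B_R$ such that $f$ restricted to $\mathbb B_{R,I}=\mathbb B_R\cap(\mathbb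 R+\mathbb RI)$ is square integrable for the measure $d\lambda(z)=\frac{\alpha}{\pi R^2}\left(1-\frac{|z|^2}{R^2}\right)^{\alpha-1}dx\,dy$, $z=x+Iy$, with $\langle f,g\rangle_{slice}=\int_{\mathbb B_{R,I}}\overline{f(z)}\,g(z)\,d\lambda(z)$ and $\|f\|_{slice}=\left(\int_{\mathbb B_{R,I}}|f|^2\,d\lambda\right)^{1/2}$. For $\varphi\in L^{2,\alpha}(\mathbb R^+,\mathbb H)$ and $q\in\mathbb B_R$ put $$\mathcal A^{\alpha}_{R,slice}\varphi(q)=\left(1-\frac qR\right)^{-\alpha-1}\int_0^{+\infty}\exp\left(\frac{tq}{q-R}\right)\varphi(t)\,\frac{t^\alpha e^{-t}}{\Gamma(\alpha+1)}\,dt,$$ where the power is the principal one. Let $$L^{(\alpha)}_n(t)=\sum_{k=0}^n\frac{\Gamma(\alpha+n+1)}{\Gamma(n-k+1)\Gamma(\alpha+k+1)}\frac{(-t)^k}{k!},\qquad \phi_n=\left(\frac{\Gamma(n+1)\Gamma(\alpha+1)}{\Gamma(\alpha+n+1)}\right)^{1/2}L_n^{(\alpha)},\qquad f_n(q)=\left(\frac{\Gamma(n+\alpha+1)}{n!\,\Gamma(\alpha+1)}\right)^{1/2}\left(\frac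 qR\right)^n .$$ **Theorem.** The integral defining $\mathcal A^{\alpha}_{R,slice}\varphi(q)$ converges absolutely for all $\varphi\in L^{2,\alpha}(\mathbb R^+,\mathbb H)$ and $q\in\mathbb B_R$. For every $I\in\mathbb S$, $\mathcal A^{\alpha}_{R,slice}$ is a right $\mathbb H$-linear bijection from $L^{2,\alpha}(\mathbb R^+,\mathbb H)$ onto $A^{2,\alpha}_{slice}(\mathbb B_R)$ that preserves norms and scalar products: $\|\mathcal A^{\alpha}_{R,slice}\varphi\|_{slice}=\|\varphi\|$ and $\langle\mathcal A^{\alpha}_{R,slice}\varphi,\mathcal A^{\alpha}_{R,slice}\psi\rangle_{slice}=\langle\varphi,\psi\rangle$. Moreover $\mathcal A^{\alpha}_{R,slice}\phi_n=f_n$ for all $n\ge0$, and $(\phi_n)_{n\ge 0}$ and $(f_n)_{n\ge 0}$ are orthonormal bases (orthonormal, with dense right $\mathbb H$-linear span) of $L^{2,\alpha}(\mathbb R^+,\mathbb H)$ and $A^{2,\alpha}_{slice}(\mathbb B_R)$ respectively. -/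

import Mathlib

open MeasureTheory
open scoped Quaternion ENNReal

namespace SliceBergman

noncomputable section

/-- The open ball of radius `R` centred at the origin of the quaternions. -/
abbrev qBall (R : ℝ) : Set ℍ[ℝ] := Metric.ball (0 : ℍ[ℝ]) R

/-- The point `x + y I` of the slice `ℝ + ℝ I`. -/
def slicePt (I : ℍ[ℝ]) (x y : ℝ) : ℍ[ℝ] := (x : ℍ[ℝ]) + (y : ℍ[ℝ]) * I

/-- The restriction `f_I`, as a function of the real coordinates `(x, y)` of `x + y I`. -/
def sliceFun (f : ℍ[ℝ] → ℍ[ℝ]) (I : ℍ[ℝ]) (p : ℝ × ℝ) : ℍ[ℝ] := f (slicePt I p.1 p.2)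

/-- The operator `(1/2) (∂/∂x + I ∂/∂y) f_I`. -/
def dbar (f : ℍ[ℝ] → ℍ[ℝ]) (I : ℍ[ℝ]) (p : ℝ × ℝ) : ℍ[ℝ] :=
  (1 / 2 : ℝ) • (fderiv ℝ (sliceFun f I) p (1, 0) + I * fderiv ℝ (sliceFun f I) p (0, 1))

/-- Left slice regularity on an open set `Ω`: real differentiability, together with
continuous first partial derivatives and the Cauchy-Riemann equation on every slice. -/
def IsSliceRegularOn (f : ℍ[ℝ] → ℍ[ℝ]) (Ω : Set ℍ[ℝ]) : Prop :=
  DifferentiableOn ℝ f Ω ∧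
    ∀ I : ℍ[ℝ], I * I = -1 →
      ContDiffOn ℝ 1 (sliceFun f I) {p : ℝ × ℝ | slicePt I p.1 p.2 ∈ Ω} ∧
      ∀ p : ℝ × ℝ, slicePt I p.1 p.2 ∈ Ω → dbar f I p = 0

open Classical in
/-- Extension by zero to all quaternions of a function on the ball. Only its values on the
(open) ball are ever used. -/
def zeroExt {R : ℝ} (f : qBall R → ℍ[ℝ]) (q : ℍ[ℝ]) : ℍ[ℝ] :=
  if h : q ∈ qBall R then f ⟨q, h⟩ else 0

/-- The measure `(α / (π R²)) (1 - |z|²/R²)^(α-1) dx dy` on the disc `|z| < R` of a slice,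
in the coordinate `z = x + i y`. -/
def discMeasure (α R : ℝ) : Measure ℂ :=
  (volume.restrict (Metric.ball (0 : ℂ) R)).withDensity
    (fun z => ENNReal.ofReal (α / (Real.pi * R ^ 2) * (1 - ‖z‖ ^ 2 / R ^ 2) ^ (α - 1)))

/-- The restriction of a function on the ball to the disc of the slice of `I`,
in the coordinate `z = x + i y`. -/
def discFun {R : ℝ} (I : ℍ[ℝ]) (f : qBall R → ℍ[ℝ]) (z : ℂ) : ℍ[ℝ] :=
  zeroExt f (slicePt I z.re z.im)

theorem zeroExt_add {R : ℝ} (f g : qBall R → ℍ[ℝ]) :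
    zeroExt (f + g) = zeroExt f + zeroExt g := by
  funext q
  by_cases h : q ∈ qBall R
  · simp only [zeroExt, h, dif_pos, Pi.add_apply]
  · simp only [zeroExt, h, dif_neg, not_false_eq_true, Pi.add_apply, add_zero]

theorem zeroExt_smul {R : ℝ} (c : ℍ[ℝ]ᵐᵒᵖ) (f : qBall R → ℍ[ℝ]) :
    zeroExt (c • f) = fun q => zeroExt f q * c.unop := by
  funext q
  by_cases h : q ∈ qBall R
  · simp only [zeroExt, h, dif_pos, Pi.smul_apply, MulOpposite.smul_eq_mul_unop]
  · simp only [zeroExt, h, dif_neg, not_false_eq_true, zero_mul]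

theorem zeroExt_zero {R : ℝ} : zeroExt (0 : qBall R → ℍ[ℝ]) = fun _ => 0 := by
  funext q
  simp [zeroExt]

theorem isOpen_slice {Ω : Set ℍ[ℝ]} (hΩ : IsOpen Ω) (I : ℍ[ℝ]) :
    IsOpen {p : ℝ × ℝ | slicePt I p.1 p.2 ∈ Ω} := by
  refine hΩ.preimage ?_
  unfold slicePt
  have h1 : Continuous fun p : ℝ × ℝ => (p.1 : ℍ[ℝ]) :=
    Quaternion.continuous_coe.comp continuous_fst
  have h2 : Continuous fun p : ℝ × ℝ => (p.2 : ℍ[ℝ]) :=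
    Quaternion.continuous_coe.comp continuous_snd
  exact h1.add (h2.mul continuous_const)

theorem IsSliceRegularOn.add {f g : ℍ[ℝ] → ℍ[ℝ]} {Ω : Set ℍ[ℝ]} (hΩ : IsOpen Ω)
    (hf : IsSliceRegularOn f Ω) (hg : IsSliceRegularOn g Ω) : IsSliceRegularOn (f + g) Ω := by
  refine ⟨hf.1.add hg.1, fun I hI => ⟨(hf.2 I hI).1.add (hg.2 I hI).1, fun p hp => ?_⟩⟩
  have hn := (isOpen_slice hΩ I).mem_nhds hp
  have h1 := ((hf.2 I hI).1.differentiableOn one_ne_zero).differentiableAt hn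
  have h2 := ((hg.2 I hI).1.differentiableOn one_ne_zero).differentiableAt hn
  have e1 := (hf.2 I hI).2 p hp
  have e2 := (hg.2 I hI).2 p hp
  have h3 : sliceFun (f + g) I = sliceFun f I + sliceFun g I := rfl
  have h4 : dbar (f + g) I p = dbar f I p + dbar g I p := by
    simp only [dbar, h3, fderiv_add h1 h2, add_apply, mul_add, smul_add]
    abel
  rw [h4, e1, e2, add_zero]

theorem IsSliceRegularOn.mul_const {f : ℍ[ℝ] → ℍ[ℝ]} {Ω : Set ℍ[ℝ]} (hΩ : IsOpen Ω)
    (hf : IsSliceRegularOn f Ω) (c : ℍ[ℝ]) : IsSliceRegularOn (fun q => f q * c) Ω := by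
  refine ⟨hf.1.mul_const c, fun I hI =>
    ⟨(hf.2 I hI).1.mul contDiffOn_const, fun p hp => ?_⟩⟩
  have hn := (isOpen_slice hΩ I).mem_nhds hp
  have h1 := ((hf.2 I hI).1.differentiableOn one_ne_zero).differentiableAt hn
  have e1 := (hf.2 I hI).2 p hp
  have h3 : sliceFun (fun q => f q * c) I = fun p => sliceFun f I p * c := rfl
  have h4 : dbar (fun q => f q * c) I p = dbar f I p * c := by
    simp only [dbar, h3, fderiv_mul_const' h1]
    simp [add_mul, mul_assoc]
  rw [h4, e1, zero_mul]

theorem isSliceRegularOn_zero (Ω : Set ℍ[ℝ]) :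
    IsSliceRegularOn (fun _ => (0 : ℍ[ℝ])) Ω := by
  refine ⟨differentiableOn_const 0, fun I _ => ⟨contDiffOn_const, fun p _ => ?_⟩⟩
  have h3 : sliceFun (fun _ => (0 : ℍ[ℝ])) I = fun _ => 0 := rfl
  simp [dbar, h3]

/-- The slice hyperholomorphic Bergman space: left slice regular functions on the ball whose
restriction to the slice of `I` is square integrable for the weighted measure.
It is a right vector space over the quaternions. -/
def bergmanSpace (α R : ℝ) (I : ℍ[ℝ]) : Submodule ℍ[ℝ]ᵐᵒᵖ (qBall R → ℍ[ℝ]) where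
  carrier := {f | IsSliceRegularOn (zeroExt f) (qBall R) ∧
    MemLp (discFun I f) 2 (discMeasure α R)}
  add_mem' := by
    rintro f g ⟨hf, hf'⟩ ⟨hg, hg'⟩
    refine ⟨?_, ?_⟩
    · rw [zeroExt_add]
      exact hf.add Metric.isOpen_ball hg
    · have h : discFun I (f + g) = discFun I f + discFun I g := by
        funext z
        simp [discFun, zeroExt_add]
      rw [h]
      exact hf'.add hg'
  zero_mem' := by
    refine ⟨?_, ?_⟩
    · rw [zeroExt_zero]
      exact isSliceRegularOn_zero _
    · have h : discFun I (0 : qBall R → ℍ[ℝ]) = 0 := by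
        funext z
        simp [discFun, zeroExt_zero]
      rw [h]
      exact MemLp.zero
  smul_mem' := by
    rintro c f ⟨hf, hf'⟩
    refine ⟨?_, ?_⟩
    · rw [zeroExt_smul]
      exact hf.mul_const Metric.isOpen_ball c.unop
    · have h : discFun I (c • f) = c • discFun I f := by
        funext z
        simp [discFun, zeroExt_smul]
      rw [h]
      exact hf'.const_smul c

/-- The quaternion-valued scalar product of the slice Bergman space. -/
def bergmanInner (α : ℝ) {R : ℝ} (I : ℍ[ℝ]) (f g : qBall R → ℍ[ℝ]) : ℍ[ℝ] :=
  ∫ z, star (discFun I f z) * discFun I g z ∂(discMeasure α R)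

/-- The norm of the slice Bergman space. -/
def bergmanNorm (α : ℝ) {R : ℝ} (I : ℍ[ℝ]) (f : qBall R → ℍ[ℝ]) : ℝ :=
  Real.sqrt (∫ z, ‖discFun I f z‖ ^ 2 ∂(discMeasure α R))

/-- The measure `t^α e^(-t) / Γ(α+1) dt` on the positive half-line. -/
def laguerreMeasure (α : ℝ) : Measure ℝ :=
  (volume.restrict (Set.Ioi (0 : ℝ))).withDensity
    (fun t => ENNReal.ofReal (t ^ α * Real.exp (-t) / Real.Gamma (α + 1)))

/-- The right quaternionic Hilbert space of (classes of) quaternion-valued functions on the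
half-line that are square integrable for `laguerreMeasure α`. -/
abbrev laguerreL2 (α : ℝ) : Type := Lp ℍ[ℝ] 2 (laguerreMeasure α)

/-- The quaternion-valued scalar product of the weighted `L²` space, conjugate-linear on the
left, as fits scalars acting on the right. -/
def laguerreInner (α : ℝ) (φ ψ : ℝ → ℍ[ℝ]) : ℍ[ℝ] :=
  ∫ t, star (φ t) * ψ t ∂(laguerreMeasure α)

/-- The generalized Laguerre polynomial `L_n^(α)`. -/
def laguerre (α : ℝ) (n : ℕ) (t : ℝ) : ℝ :=
  ∑ k ∈ Finset.range (n + 1),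
    Real.Gamma (α + n + 1) / (Real.Gamma ((n : ℝ) - k + 1) * Real.Gamma (α + k + 1))
      * ((-t) ^ k / (k.factorial : ℝ))

/-- The normalized Laguerre functions `φ_n`. -/
def laguerreBasis (α : ℝ) (n : ℕ) (t : ℝ) : ℍ[ℝ] :=
  ((Real.sqrt (Real.Gamma (n + 1) * Real.Gamma (α + 1) / Real.Gamma (α + n + 1))
    * laguerre α n t : ℝ) : ℍ[ℝ])

/-- The normalized monomials `f_n`. -/
def monomialBasis (α R : ℝ) (n : ℕ) (q : qBall R) : ℍ[ℝ] :=
  ((Real.sqrt (Real.Gamma (n + α + 1) / ((n.factorial : ℝ) * Real.Gamma (α + 1))) : ℝ) : ℍ[ℝ])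
    * ((q : ℍ[ℝ]) / (R : ℍ[ℝ])) ^ n

/-- The principal logarithm of a quaternion: `log (x + y J) = log |x + i y| + arg (x + i y) J`
for an imaginary unit `J` and `y ≥ 0`, where `arg` is the principal argument. -/
def qLog (w : ℍ[ℝ]) : ℍ[ℝ] :=
  (Real.log ‖w‖ : ℍ[ℝ]) + (Complex.arg ⟨w.re, ‖w.im‖⟩ : ℍ[ℝ]) * (‖w.im‖⁻¹ • w.im)

/-- The principal real power `w ^ s = exp (s log w)` of a quaternion. -/
def qPow (w : ℍ[ℝ]) (s : ℝ) : ℍ[ℝ] := NormedSpace.exp (s • qLog w)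

/-- The quaternionic second Bargmann transform. -/
def bargmann (α R : ℝ) (φ : ℝ → ℍ[ℝ]) (q : ℍ[ℝ]) : ℍ[ℝ] :=
  qPow (1 - q / (R : ℍ[ℝ])) (-α - 1) *
    ∫ t, NormedSpace.exp (t • (q / (q - (R : ℍ[ℝ])))) * φ t ∂(laguerreMeasure α)

end

end SliceBergman

/-! Both spaces are identified with the same weighted `ℓ²` space of quaternionic sequences, and the
transform is the identity in these coordinates.

The link is the generating function `∑ wⁿ Lₙ(t) = (1-w)^(-α-1) exp(tw/(w-1))` for `|w| < 1`
(`hasSum_laguerre`). Every quaternion lies on a slice `ℝ + ℝJ`, a copy of `ℂ` acting on `ℍ` by left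
multiplication, and on it the quaternionic exponential and power are the complex ones. Integrating
the generating function at `w = q/R` against `φ` gives `bargmann φ q = ∑ (q/R)ⁿ cₙ`, with `cₙ = ∫ Lₙ
φ` on the right (`hasSum_bargmann`).

On the half-line, the Laguerre polynomials are orthogonal, with square norms the binomial
coefficients `bₙ = Γ(α+1+n)/(n! Γ(α+1))`, and complete; hence `‖φ‖² = ∑ |cₙ|²/bₙ`, and every
sequence with finite sum occurs (`laguerreCoordinates`). On the ball, slice regular functions are
exactly the sums of power series `∑ qⁿ aₙ` (`isSliceRegularOn_of_hasSum`,
`IsSliceRegularOn.exists_hasSum`). Parseval on circles and a Beta integral in the radius show that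
the slice norm of `∑ (q/R)ⁿ cₙ` is again `∑ |cₙ|²/bₙ` (`lintegral_discFun`), whatever the slice.

Equality of the two sums gives isometry and surjectivity. Right linearity and polarization with
quaternionic scalars give the scalar product, and the statements on bases are transported from one
side to the other. -/

namespace SliceBergman

/-! ### Slices as copies of the complex plane -/

/-- The embedding `x + i y ↦ x + J y` of the complex numbers in the quaternions. -/
noncomputable def sliceEmb (J : ℍ[ℝ]) (hJ : J * J = -1) : ℂ →ₐ[ℝ] ℍ[ℝ] := Complex.liftAux J hJ

theorem sliceEmb_eq_slicePt (J : ℍ[ℝ]) (hJ : J * J = -1) (z : ℂ) :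
    sliceEmb J hJ z = slicePt J z.re z.im := by
  rw [sliceEmb, Complex.liftAux_apply, slicePt, ← Quaternion.coe_mul_eq_smul]
  rfl

theorem imaginaryUnit_re {J : ℍ[ℝ]} (hJ : J * J = -1) : J.re = 0 := by
  have h0 := congrArg QuaternionAlgebra.re hJ
  have h1 := congrArg QuaternionAlgebra.imI hJ
  have h2 := congrArg QuaternionAlgebra.imJ hJ
  have h3 := congrArg QuaternionAlgebra.imK hJ
  simp at h0 h1 h2 h3
  by_contra h
  have e1 : J.imI = 0 := by
    have : J.re * J.imI = 0 := by linarith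
    simpa [h] using this
  have e2 : J.imJ = 0 := by
    have : J.re * J.imJ = 0 := by linarith
    simpa [h] using this
  have e3 : J.imK = 0 := by
    have : J.re * J.imK = 0 := by linarith
    simpa [h] using this
  rw [e1, e2, e3] at h0
  nlinarith [sq_nonneg J.re]

theorem imaginaryUnit_star {J : ℍ[ℝ]} (hJ : J * J = -1) : star J = -J := by
  have := imaginaryUnit_re hJ
  ext <;> simp [this]

theorem imaginaryUnit_norm {J : ℍ[ℝ]} (hJ : J * J = -1) : ‖J‖ = 1 := by
  have h := congrArg norm hJ
  rw [norm_mul, norm_neg, norm_one] at h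
  nlinarith [norm_nonneg J]

theorem star_sliceEmb (J : ℍ[ℝ]) (hJ : J * J = -1) (z : ℂ) :
    star (sliceEmb J hJ z) = sliceEmb J hJ (star z) := by
  simp only [sliceEmb_eq_slicePt, slicePt, star_add, star_mul, imaginaryUnit_star hJ,
    Quaternion.star_coe]
  simp [(Quaternion.coe_commutes z.im J).symm]

theorem sliceEmb_ofReal (J : ℍ[ℝ]) (hJ : J * J = -1) (x : ℝ) :
    sliceEmb J hJ (x : ℂ) = (x : ℍ[ℝ]) := by
  exact (sliceEmb J hJ).commutes x

theorem norm_sliceEmb (J : ℍ[ℝ]) (hJ : J * J = -1) (z : ℂ) : ‖sliceEmb J hJ z‖ = ‖z‖ := by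
  have h : star (sliceEmb J hJ z) * sliceEmb J hJ z = ((‖z‖ ^ 2 : ℝ) : ℍ[ℝ]) := by
    rw [star_sliceEmb, ← map_mul, ← sliceEmb_ofReal J hJ]
    congr 1
    have := Complex.conj_mul' z
    simpa using this
  have h2 := congrArg norm h
  rw [norm_mul, norm_star, Quaternion.norm_coe, Real.norm_of_nonneg (by positivity)] at h2
  rw [← sq] at h2
  exact (pow_left_inj₀ (norm_nonneg _) (norm_nonneg _) two_ne_zero).mp h2

theorem continuous_sliceEmb (J : ℍ[ℝ]) (hJ : J * J = -1) : Continuous (sliceEmb J hJ) :=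
  (sliceEmb J hJ).toLinearMap.continuous_of_finiteDimensional

theorem exp_sliceEmb (J : ℍ[ℝ]) (hJ : J * J = -1) (z : ℂ) :
    NormedSpace.exp (sliceEmb J hJ z) = sliceEmb J hJ (Complex.exp z) := by
  rw [Complex.exp_eq_exp_ℂ]
  exact (NormedSpace.map_exp (sliceEmb J hJ) (continuous_sliceEmb J hJ) z).symm

/-- Every quaternion lies on a slice. -/
theorem exists_sliceEmb_eq (q : ℍ[ℝ]) :
    ∃ (J : ℍ[ℝ]) (hJ : J * J = -1) (z : ℂ), q = sliceEmb J hJ z := by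
  by_cases h : q.im = 0
  -- A real quaternion lies on every slice, so any imaginary unit will do.
  · refine ⟨Quaternion.ofComplex Complex.I, ?_, (q.re : ℂ), ?_⟩
    · rw [← map_mul, Complex.I_mul_I, map_neg, map_one]
    · rw [sliceEmb_ofReal]
      conv_lhs => rw [← Quaternion.re_add_im q, h, add_zero]
  · have hn : ‖q.im‖ ≠ 0 := norm_ne_zero_iff.mpr h
    have hJ : (‖q.im‖⁻¹ • q.im) * (‖q.im‖⁻¹ • q.im) = -1 := by
      have h1 : q.im * q.im = -((‖q.im‖ * ‖q.im‖ : ℝ) : ℍ[ℝ]) := by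
        rw [← Quaternion.normSq_eq_norm_mul_self, ← Quaternion.self_mul_star, Quaternion.star_im,
          mul_neg, neg_neg]
      rw [smul_mul_smul_comm, h1, smul_neg, ← Quaternion.coe_mul_eq_smul, ← Quaternion.coe_mul]
      field_simp
      simp
    refine ⟨‖q.im‖⁻¹ • q.im, hJ, ⟨q.re, ‖q.im‖⟩, ?_⟩
    rw [sliceEmb_eq_slicePt, slicePt, Quaternion.coe_mul_eq_smul, smul_smul, mul_inv_cancel₀ hn,
      one_smul]
    exact (Quaternion.re_add_im q).symm

/-- `qLog` uses the unit along the imaginary part, which is `-J` when `z` is in the lower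
half-plane; there the argument also changes sign, so the product is unaffected. The right half-plane
avoids the cut, where the sign rule fails. -/
theorem qLog_sliceEmb (J : ℍ[ℝ]) (hJ : J * J = -1) {z : ℂ} (hz : 0 < z.re) :
    qLog (sliceEmb J hJ z) = sliceEmb J hJ (Complex.log z) := by
  have hre : (sliceEmb J hJ z).re = z.re := by
    rw [sliceEmb_eq_slicePt]; simp [slicePt, imaginaryUnit_re hJ]
  have him : (sliceEmb J hJ z).im = z.im • J := by
    rw [sliceEmb_eq_slicePt]
    have := imaginaryUnit_re hJ
    ext <;> simp [slicePt, this]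
  have hnim : ‖(sliceEmb J hJ z).im‖ = |z.im| := by
    rw [him, norm_smul, imaginaryUnit_norm hJ, mul_one, Real.norm_eq_abs]
  rw [qLog, hre, hnim, norm_sliceEmb, him, sliceEmb_eq_slicePt, slicePt, Complex.log_re,
    Complex.log_im, smul_smul]
  congr 1
  rcases lt_trichotomy z.im 0 with h | h | h
  · rw [abs_of_neg h]
    have e : (⟨z.re, -z.im⟩ : ℂ) = (starRingEnd ℂ) z := by apply Complex.ext <;> simp
    have hpi : Complex.arg z ≠ Real.pi := by
      intro hh
      have := Complex.arg_eq_pi_iff.mp hh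
      linarith [this.1]
    rw [e, Complex.arg_conj, if_neg hpi, Quaternion.coe_mul_eq_smul, Quaternion.coe_mul_eq_smul,
      smul_smul]
    congr 1
    field_simp [h.ne]
  · have e : Complex.arg z = 0 := by
      rw [Complex.arg_eq_zero_iff]
      exact ⟨hz.le, h⟩
    rw [h, e]; simp
  · rw [abs_of_pos h, inv_mul_cancel₀ h.ne', one_smul]

theorem qPow_sliceEmb (J : ℍ[ℝ]) (hJ : J * J = -1) {z : ℂ} (hz : 0 < z.re) (s : ℝ) :
    qPow (sliceEmb J hJ z) s = sliceEmb J hJ (z ^ (s : ℂ)) := by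
  have h0 : z ≠ 0 := by rintro rfl; simp at hz
  rw [qPow, qLog_sliceEmb J hJ hz, ← map_smul, exp_sliceEmb, Complex.cpow_def_of_ne_zero h0]
  congr 2
  rw [Complex.real_smul, mul_comm]

/-- The complex structure on the quaternions given by left multiplication by the imaginary
unit `J`. -/
@[reducible] noncomputable def sliceNormedSpace (J : ℍ[ℝ]) (hJ : J * J = -1) :
    NormedSpace ℂ ℍ[ℝ] :=
  { Module.compHom ℍ[ℝ] (sliceEmb J hJ : ℂ →+* ℍ[ℝ]) with
    norm_smul_le := fun z q => by
      change ‖sliceEmb J hJ z * q‖ ≤ _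
      rw [norm_mul, norm_sliceEmb] }

theorem sliceNormedSpace_isScalarTower (J : ℍ[ℝ]) (hJ : J * J = -1) :
    letI := sliceNormedSpace J hJ
    IsScalarTower ℝ ℂ ℍ[ℝ] := by
  let := sliceNormedSpace J hJ
  refine ⟨fun a b c => ?_⟩
  change sliceEmb J hJ (a • b) * c = a • (sliceEmb J hJ b * c)
  rw [map_smul, smul_mul_assoc]

/-! ### The binomial series and the Laguerre generating function -/

/-- The coefficients `Γ(s+n) / (n! Γ(s))` of the binomial series of `(1 - x)^(-s)`. -/
noncomputable def binomCoef (s : ℝ) (n : ℕ) : ℝ :=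
  Real.Gamma (s + n) / (n.factorial * Real.Gamma s)

theorem binomCoef_pos {s : ℝ} (hs : 0 < s) (n : ℕ) : 0 < binomCoef s n := by
  have h1 := Real.Gamma_pos_of_pos hs
  have h2 : 0 < Real.Gamma (s + n) := Real.Gamma_pos_of_pos (by positivity)
  unfold binomCoef
  positivity

theorem Gamma_add_natCast {s : ℝ} (hs : 0 < s) (n : ℕ) :
    Real.Gamma (s + n) = (ascPochhammer ℝ n).eval s * Real.Gamma s := by
  induction n with
  | zero => simp
  | succ n ih =>
    rw [Nat.cast_succ, ← add_assoc, Real.Gamma_add_one (by positivity), ih,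
      ascPochhammer_succ_eval]
    ring

theorem binomCoef_eq_choose {s : ℝ} (hs : 0 < s) (n : ℕ) :
    binomCoef s n = Ring.choose (s + n - 1) n := by
  have h := Ring.factorial_nsmul_multichoose_eq_ascPochhammer s n
  rw [Polynomial.ascPochhammer_smeval_eq_eval, nsmul_eq_mul] at h
  have e : Ring.choose (s + n - 1) n = Ring.multichoose s n := by
    rw [Ring.choose]
    congr 1
    ring
  have hf : (n.factorial : ℝ) ≠ 0 := by positivity
  rw [e, binomCoef, Gamma_add_natCast hs, ← h]
  field_simp [(Real.Gamma_pos_of_pos hs).ne']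

theorem hasSum_binomCoef {s : ℝ} (hs : 0 < s) {w : ℂ} (hw : ‖w‖ < 1) :
    HasSum (fun n : ℕ => w ^ n * (binomCoef s n : ℂ)) ((1 - w) ^ (-(s : ℂ))) := by
  have h := (Complex.one_div_one_sub_cpow_hasFPowerSeriesOnBall_zero (s : ℂ)).hasSum (y := w)
    (by simpa [enorm_eq_nnnorm, ← NNReal.coe_lt_coe] using hw)
  rw [zero_add, one_div, ← Complex.cpow_neg] at h
  refine h.congr_fun fun n => ?_
  rw [binomCoef_eq_choose hs, Complex.ofReal_choose]
  simp

theorem summable_binomCoef {s : ℝ} (hs : 0 < s) {r : ℝ} (h0 : 0 ≤ r) (hr : r < 1) :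
    Summable fun n : ℕ => r ^ n * binomCoef s n := by
  have h := (hasSum_binomCoef hs (w := (r : ℂ)) (by simpa [abs_of_nonneg h0] using hr)).summable
  have := Complex.reCLM.summable h
  refine this.congr fun n => ?_
  simp only [Complex.reCLM_apply]
  norm_cast

theorem tsum_binomCoef {s : ℝ} (hs : 0 < s) {r : ℝ} (h0 : 0 ≤ r) (hr : r < 1) :
    ∑' n : ℕ, r ^ n * binomCoef s n = (1 - r) ^ (-s) := by
  have h := (hasSum_binomCoef hs (w := (r : ℂ)) (by simpa [abs_of_nonneg h0] using hr)).tsum_eq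
  have e : ((1 : ℂ) - r) ^ (-(s : ℂ)) = (((1 - r) ^ (-s) : ℝ) : ℂ) := by
    rw [Complex.ofReal_cpow (by linarith)]
    push_cast
    rfl
  rw [e] at h
  have h2 : ((∑' n : ℕ, r ^ n * binomCoef s n : ℝ) : ℂ) = (((1 - r) ^ (-s) : ℝ) : ℂ) := by
    rw [← h, Complex.ofReal_tsum]
    push_cast
    rfl
  exact_mod_cast h2

/-- The coefficient of `(-t)^k / k!` is that of `w^(n-k)` in `(1-w)^(-(α+1+k))`, which exhibits `Lₙ`
as an antidiagonal sum of a double series. -/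
theorem laguerre_eq_sum_binomCoef {α : ℝ} (n : ℕ) (t : ℝ) :
    laguerre α n t = ∑ k ∈ Finset.range (n + 1),
      binomCoef (α + 1 + k) (n - k) * ((-t) ^ k / (k.factorial : ℝ)) := by
  refine Finset.sum_congr rfl fun k hk => ?_
  have hkn : k ≤ n := Nat.lt_succ_iff.mp (Finset.mem_range.mp hk)
  rw [binomCoef, ← Nat.cast_sub hkn, Real.Gamma_nat_eq_factorial, Nat.cast_sub hkn]
  congr 3 <;> ring_nf

/-- The generating function of the Laguerre polynomials. -/
theorem hasSum_laguerre {α : ℝ} (hα : 0 < α) (t : ℝ) {w : ℂ} (hw : ‖w‖ < 1) :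
    HasSum (fun n : ℕ => w ^ n * (laguerre α n t : ℂ))
      ((1 - w) ^ (-((α + 1 : ℝ) : ℂ)) * Complex.exp (t * (w / (w - 1)))) := by
  have h1w : 1 - w ≠ 0 := by
    intro h
    rw [← sub_eq_zero.mp h] at hw
    simp at hw
  have hs (k : ℕ) : 0 < α + 1 + k := by positivity
  -- Summing this family over the second index gives `(1-w)^(-(α+1+k))`, and then over `k` the
  -- exponential; summing it along antidiagonals gives `wⁿ Lₙ(t)`.
  set f : ℕ × ℕ → ℂ := fun p =>
    ((-t * w) ^ p.1 / (p.1.factorial : ℂ)) * (w ^ p.2 * (binomCoef (α + 1 + p.1) p.2 : ℂ)) with hf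
  have hnf (p : ℕ × ℕ) : ‖f p‖ = ((|t| * ‖w‖) ^ p.1 / (p.1.factorial : ℝ)) *
      (‖w‖ ^ p.2 * binomCoef (α + 1 + p.1) p.2) := by
    simp [hf, abs_of_pos (binomCoef_pos (hs p.1) p.2)]
  have hsum : Summable f := by
    apply Summable.of_norm
    rw [summable_prod_of_nonneg fun _ => norm_nonneg _]
    constructor
    · intro k
      simp only [hnf]
      exact (summable_binomCoef (hs k) (norm_nonneg w) hw).mul_left _
    -- The row sums of the norms are the terms of the exponential series at `|t||w|/(1-|w|)`, up to
    -- the factor `(1-|w|)^(-(α+1))`.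
    · simp only [hnf, tsum_mul_left]
      have h1 : 0 < 1 - ‖w‖ := by linarith
      have := (Real.summable_pow_div_factorial ((|t| * ‖w‖) * (1 - ‖w‖)⁻¹)).mul_left
        ((1 - ‖w‖) ^ (-(α + 1)))
      refine this.congr fun k => ?_
      rw [tsum_binomCoef (hs k) (norm_nonneg w) hw, neg_add (α + 1), Real.rpow_add h1 (-(α + 1)),
        Real.rpow_neg h1.le (k : ℝ), Real.rpow_natCast, mul_pow _ (1 - ‖w‖)⁻¹, inv_pow]
      ring
  have htot : HasSum f ((1 - w) ^ (-((α + 1 : ℝ) : ℂ)) * Complex.exp (t * (w / (w - 1)))) := by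
    have h2 := hsum.hasSum.prod_fiberwise
      (fun k => (hasSum_binomCoef (hs k) hw).mul_left ((-t * w) ^ k / (k.factorial : ℂ)))
    have h3 := (NormedSpace.expSeries_div_hasSum_exp (t * (w / (w - 1)))).mul_left
      ((1 - w) ^ (-((α + 1 : ℝ) : ℂ)))
    rw [← Complex.exp_eq_exp_ℂ] at h3
    convert hsum.hasSum using 1
    refine h3.unique (h2.congr_fun fun k => ?_)
    have e : w / (w - 1) = -w * (1 - w)⁻¹ := by
      rw [← neg_sub 1 w, div_neg, div_eq_mul_inv, neg_mul]
    have e2 : (-(((α + 1 + k : ℝ)) : ℂ)) = -((α + 1 : ℝ) : ℂ) - (k : ℂ) := by push_cast; ring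
    rw [e, e2, Complex.cpow_sub _ _ h1w, Complex.cpow_natCast, ← mul_assoc, mul_pow _ (1 - w)⁻¹,
      inv_pow, show (t : ℂ) * -w = -t * w by ring]
    ring
  have h4 := (Finset.HasAntidiagonal.sigmaAntidiagonalEquivProd.hasSum_iff.mpr htot).sigma
    fun n => hasSum_fintype _
  refine h4.congr_fun fun n => ?_
  simp only [Function.comp, Finset.HasAntidiagonal.sigmaAntidiagonalEquivProd_apply]
  rw [Finset.sum_coe_sort (Finset.HasAntidiagonal.antidiagonal n) f, Finset.Nat.sum_antidiagonal_eq_sum_range_succ_mk,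
    laguerre_eq_sum_binomCoef]
  push_cast
  rw [Finset.mul_sum]
  refine Finset.sum_congr rfl fun k hk => ?_
  have hkn : k ≤ n := Nat.lt_succ_iff.mp (Finset.mem_range.mp hk)
  obtain ⟨m, rfl⟩ := Nat.exists_eq_add_of_le hkn
  simp only [hf, Nat.add_sub_cancel_left]
  rw [mul_pow, pow_add]
  ring

/-! ### The Laguerre measure: moments and orthogonality -/

section LaguerreMeasure

variable {E : Type*} [NormedAddCommGroup E] [NormedSpace ℝ E]

theorem measurable_laguerreDensity (α : ℝ) :
    Measurable fun t : ℝ => ENNReal.ofReal (t ^ α * Real.exp (-t) / Real.Gamma (α + 1)) := by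
  fun_prop

theorem laguerreDensity_toReal {α : ℝ} (hα : 0 < α) {t : ℝ} (ht : t ∈ Set.Ioi (0 : ℝ)) :
    (ENNReal.ofReal (t ^ α * Real.exp (-t) / Real.Gamma (α + 1))).toReal =
      t ^ α * Real.exp (-t) / Real.Gamma (α + 1) := by
  have := Real.Gamma_pos_of_pos (show 0 < α + 1 by positivity)
  have ht' : 0 < t := ht
  exact ENNReal.toReal_ofReal (by positivity)

theorem integral_laguerreMeasure {α : ℝ} (hα : 0 < α) (f : ℝ → E) :
    ∫ t, f t ∂(laguerreMeasure α) =
      ∫ t in Set.Ioi (0 : ℝ), (t ^ α * Real.exp (-t) / Real.Gamma (α + 1)) • f t := by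
  rw [laguerreMeasure, integral_withDensity_eq_integral_toReal_smul
    (measurable_laguerreDensity α) (by simp)]
  exact setIntegral_congr_fun measurableSet_Ioi fun t ht => by
    simp only [laguerreDensity_toReal hα ht]

theorem integrable_laguerreMeasure_iff {α : ℝ} (hα : 0 < α) (f : ℝ → E) :
    Integrable f (laguerreMeasure α) ↔
      IntegrableOn (fun t => (t ^ α * Real.exp (-t) / Real.Gamma (α + 1)) • f t)
        (Set.Ioi (0 : ℝ)) := by
  rw [laguerreMeasure, integrable_withDensity_iff_integrable_smul'
    (measurable_laguerreDensity α) (by simp)]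
  exact integrableOn_congr_fun (fun t ht => by
    simp only [laguerreDensity_toReal hα ht]) measurableSet_Ioi

end LaguerreMeasure

theorem integrable_exp_laguerreMeasure {α : ℝ} (hα : 0 < α) {c : ℝ} (hc : c < 1) :
    Integrable (fun t : ℝ => Real.exp (c * t)) (laguerreMeasure α) := by
  rw [integrable_laguerreMeasure_iff hα]
  have h := (integrableOn_rpow_mul_exp_neg_mul_rpow (s := α) (p := 1) (b := 1 - c)
    (by linarith) one_pos (by linarith)).const_mul (Real.Gamma (α + 1))⁻¹
  refine IntegrableOn.congr_fun h (fun t _ => ?_) measurableSet_Ioi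
  simp only [Real.rpow_one, smul_eq_mul]
  rw [show -(1 - c) * t = -t + c * t by ring, Real.exp_add]
  ring

theorem integrable_pow_laguerreMeasure {α : ℝ} (hα : 0 < α) (k : ℕ) :
    Integrable (fun t : ℝ => t ^ k) (laguerreMeasure α) := by
  rw [integrable_laguerreMeasure_iff hα]
  have h := (Real.GammaIntegral_convergent (s := α + k + 1) (by positivity)).const_mul
    (Real.Gamma (α + 1))⁻¹
  refine IntegrableOn.congr_fun h (fun t ht => ?_) measurableSet_Ioi
  simp only [smul_eq_mul]
  rw [add_sub_cancel_right, Real.rpow_add ht, Real.rpow_natCast]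
  ring

theorem integral_pow_laguerreMeasure {α : ℝ} (hα : 0 < α) (k : ℕ) :
    ∫ t, t ^ k ∂(laguerreMeasure α) = Real.Gamma (α + k + 1) / Real.Gamma (α + 1) := by
  rw [integral_laguerreMeasure hα, Real.Gamma_eq_integral (s := α + k + 1) (by positivity),
    div_eq_inv_mul, ← integral_const_mul]
  refine setIntegral_congr_fun measurableSet_Ioi fun t ht => ?_
  simp only [smul_eq_mul]
  rw [add_sub_cancel_right, Real.rpow_add ht, Real.rpow_natCast]
  ring

theorem isFiniteMeasure_laguerreMeasure {α : ℝ} (hα : 0 < α) :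
    IsFiniteMeasure (laguerreMeasure α) := by
  have h := integrable_pow_laguerreMeasure hα 0
  simp only [pow_zero] at h
  exact (integrable_const_iff.mp h).resolve_left one_ne_zero

theorem memLp_pow_laguerreMeasure {α : ℝ} (hα : 0 < α) (k : ℕ) :
    MemLp (fun t : ℝ => t ^ k) 2 (laguerreMeasure α) := by
  rw [memLp_two_iff_integrable_sq (by fun_prop)]
  simp only [← pow_mul]
  exact integrable_pow_laguerreMeasure hα _

theorem continuous_laguerre (α : ℝ) (n : ℕ) : Continuous (laguerre α n) := by
  unfold laguerre
  fun_prop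

theorem memLp_laguerre {α : ℝ} (hα : 0 < α) (n : ℕ) :
    MemLp (laguerre α n) 2 (laguerreMeasure α) := by
  have h : laguerre α n = fun t => ∑ k ∈ Finset.range (n + 1),
      (Real.Gamma (α + n + 1) / (Real.Gamma ((n : ℝ) - k + 1) * Real.Gamma (α + k + 1))
        * ((-1) ^ k / (k.factorial : ℝ))) * t ^ k := by
    funext t
    refine Finset.sum_congr rfl fun k _ => ?_
    rw [neg_pow]
    ring
  rw [h]
  exact memLp_finsetSum _ fun k _ => (memLp_pow_laguerreMeasure hα k).const_mul _

/-- The factors `(-1)^k * n.choose k` prepare the reading of moments against `Lₙ` as `n`-th finite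
differences. -/
theorem laguerre_eq_sum_pow (α : ℝ) (n : ℕ) (t : ℝ) :
    laguerre α n t = ∑ k ∈ Finset.range (n + 1),
      (Real.Gamma (α + n + 1) / (n.factorial * Real.Gamma (α + k + 1))
        * ((-1) ^ k * n.choose k)) * t ^ k := by
  refine Finset.sum_congr rfl fun k hk => ?_
  have hkn : k ≤ n := Nat.lt_succ_iff.mp (Finset.mem_range.mp hk)
  rw [← Nat.cast_sub hkn, Real.Gamma_nat_eq_factorial, Nat.cast_choose ℝ hkn, neg_pow]
  have h1 : (n.factorial : ℝ) ≠ 0 := by positivity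
  have h2 : (k.factorial : ℝ) ≠ 0 := by positivity
  have h3 : ((n - k).factorial : ℝ) ≠ 0 := by positivity
  field_simp

theorem integrable_pow_mul_laguerre {α : ℝ} (hα : 0 < α) (j n : ℕ) :
    Integrable (fun t => t ^ j * laguerre α n t) (laguerreMeasure α) :=
  (memLp_pow_laguerreMeasure hα j).integrable_mul (memLp_laguerre hα n)

/-- The moment of order `j + k` contributes `Γ(α+1+k+j)`, which is the rising factorial of length
`j` at `α+1+k` times `Γ(α+1+k)`. The last factor cancels the denominator in `Lₙ`, and what remains
is an alternating binomial sum of values of a polynomial of degree `j`. -/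
theorem integral_pow_mul_laguerre {α : ℝ} (hα : 0 < α) (j n : ℕ) :
    ∫ t, t ^ j * laguerre α n t ∂(laguerreMeasure α) =
      Real.Gamma (α + n + 1) / (n.factorial * Real.Gamma (α + 1)) * ((-1) ^ n *
        (fwdDiff 1)^[n] (ascPochhammer ℝ j).eval (α + 1)) := by
  simp only [laguerre_eq_sum_pow, Finset.mul_sum]
  rw [integral_finsetSum, fwdDiff_iter_eq_sum_shift, Finset.mul_sum, Finset.mul_sum]
  · refine Finset.sum_congr rfl fun k hk => ?_
    have hkn : k ≤ n := Nat.lt_succ_iff.mp (Finset.mem_range.mp hk)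
    obtain ⟨m, rfl⟩ := Nat.exists_eq_add_of_le hkn
    simp only [mul_left_comm (_ ^ j), ← pow_add]
    rw [integral_const_mul, integral_pow_laguerreMeasure hα,
      show α + ((j + k : ℕ) : ℝ) + 1 = α + 1 + k + j by push_cast; ring,
      Gamma_add_natCast (s := α + 1 + k) (by positivity), show α + k + 1 = α + 1 + k by ring]
    have h1 := (Real.Gamma_pos_of_pos (show 0 < α + 1 + k by positivity)).ne'
    have h2 := (Real.Gamma_pos_of_pos (show 0 < α + 1 by positivity)).ne'
    have h3 : ((-1 : ℝ)) ^ (k + m) * (-1) ^ m = (-1) ^ k := by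
      rw [pow_add, mul_assoc, ← mul_pow]; simp
    simp only [Nat.add_sub_cancel_left, zsmul_eq_mul, nsmul_eq_mul, mul_one]
    push_cast
    rw [← h3]
    field_simp
  · intro k _
    simp only [mul_left_comm (_ ^ j), ← pow_add]
    exact (integrable_pow_laguerreMeasure hα _).const_mul _

theorem integral_pow_mul_laguerre_of_lt {α : ℝ} (hα : 0 < α) {j n : ℕ} (h : j < n) :
    ∫ t, t ^ j * laguerre α n t ∂(laguerreMeasure α) = 0 := by
  rw [integral_pow_mul_laguerre hα, Polynomial.fwdDiff_iter_eq_zero_of_degree_lt]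
  · simp
  · rwa [ascPochhammer_natDegree]

/-- With `m ≤ n`, expand `Lₘ` in powers: an `n`-th difference kills degrees below `n`, so only the
top power with `m = n` survives, and there the `n`-th difference of a monic polynomial of degree `n`
is `n!`. -/
theorem integral_laguerre_mul_laguerre {α : ℝ} (hα : 0 < α) (m n : ℕ) :
    ∫ t, laguerre α m t * laguerre α n t ∂(laguerreMeasure α) =
      if m = n then binomCoef (α + 1) n else 0 := by
  wlog hmn : m ≤ n generalizing m n
  · have := this n m (le_of_not_ge hmn)
    simp only [mul_comm (laguerre α m _)]
    rw [this]
    by_cases h : m = n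
    · simp [h]
    · simp [h, Ne.symm h]
  have hi (k : ℕ) (c : ℝ) : Integrable (fun t => c * t ^ k * laguerre α n t)
      (laguerreMeasure α) := by
    simp only [mul_assoc]
    exact (integrable_pow_mul_laguerre hα k n).const_mul c
  have hv (k : ℕ) (c : ℝ) : ∫ t, c * t ^ k * laguerre α n t ∂(laguerreMeasure α) =
      c * ∫ t, t ^ k * laguerre α n t ∂(laguerreMeasure α) := by
    simp only [mul_assoc]
    exact integral_const_mul _ _
  simp only [laguerre_eq_sum_pow α m, Finset.sum_mul]
  rw [integral_finsetSum _ fun k _ => hi k _]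
  simp only [hv]
  rw [Finset.sum_range_succ, Finset.sum_eq_zero, zero_add]
  · split_ifs with h
    · subst h
      have h4 := (ascPochhammer ℝ m).fwdDiff_iter_degree_eq_factorial
      rw [ascPochhammer_natDegree, (monic_ascPochhammer ℝ m).leadingCoeff] at h4
      rw [integral_pow_mul_laguerre hα, h4, binomCoef, show α + 1 + m = α + m + 1 by ring]
      have h1 := (Real.Gamma_pos_of_pos (show 0 < α + m + 1 by positivity)).ne'
      have h2 := (Real.Gamma_pos_of_pos (show 0 < α + 1 by positivity)).ne'
      have h3 : (m.factorial : ℝ) ≠ 0 := by positivity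
      have h5 : ((-1 : ℝ)) ^ m * (-1) ^ m = 1 := by
        rw [← mul_pow]; simp
      simp
      field_simp
      linear_combination h5
    · rw [integral_pow_mul_laguerre_of_lt hα (lt_of_le_of_ne hmn h), mul_zero]
  · intro k hk
    rw [integral_pow_mul_laguerre_of_lt hα (lt_of_lt_of_le (Finset.mem_range.mp hk) hmn), mul_zero]

/-! ### The Laguerre expansion of the kernel, and completeness -/

/-- The bound `1/2` is exactly what makes `exp(ts)` square integrable against the factor `e^(-t)`.
-/
theorem re_div_sub_one_lt {w : ℂ} (hw : ‖w‖ < 1) : (w / (w - 1)).re < 1 / 2 := by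
  have hne : w - 1 ≠ 0 := by
    intro h
    rw [sub_eq_zero.mp h] at hw
    simp at hw
  have h1 : 0 < Complex.normSq (w - 1) := Complex.normSq_pos.mpr hne
  have h2 : Complex.normSq w < 1 := by
    rw [Complex.normSq_eq_norm_sq]
    exact pow_lt_one₀ (norm_nonneg w) hw two_ne_zero
  rw [Complex.div_re, ← add_div, div_lt_div_iff₀ h1 two_pos]
  simp only [Complex.normSq_apply, Complex.sub_re, Complex.sub_im, Complex.one_re,
    Complex.one_im] at *
  nlinarith

theorem memLp_cexp {α : ℝ} (hα : 0 < α) {s : ℂ} (hs : s.re < 1 / 2) :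
    MemLp (fun t : ℝ => Complex.exp (t * s)) 2 (laguerreMeasure α) := by
  have hc : Continuous fun t : ℝ => Complex.exp (t * s) := by fun_prop
  rw [memLp_two_iff_integrable_sq_norm hc.aestronglyMeasurable]
  refine (integrable_exp_laguerreMeasure hα (c := 2 * s.re) (by linarith)).congr ?_
  filter_upwards with t
  rw [Complex.norm_exp, ← Real.exp_nat_mul]
  congr 1
  simp
  ring

section Expansion

variable {E : Type*} [NormedAddCommGroup E] [NormedSpace ℝ E]

theorem integrable_laguerre_smul {α : ℝ} (hα : 0 < α) {g : ℝ → E}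
    (hg : MemLp g 2 (laguerreMeasure α)) (n : ℕ) :
    Integrable (fun t => laguerre α n t • g t) (laguerreMeasure α) :=
  memLp_one_iff_integrable.mp (hg.smul (memLp_laguerre hα n))

/-- The bound `|Lₙ| |g| ≤ Lₙ² + |g|²` is crude but sufficient: `∑ rⁿ bₙ` converges for `r < 1`,
which justifies exchanging sum and integral. -/
theorem integral_norm_laguerre_smul_le {α : ℝ} (hα : 0 < α) {g : ℝ → E}
    (hg : MemLp g 2 (laguerreMeasure α)) (n : ℕ) :
    ∫ t, ‖laguerre α n t • g t‖ ∂(laguerreMeasure α) ≤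
      binomCoef (α + 1) n + ∫ t, ‖g t‖ ^ 2 ∂(laguerreMeasure α) := by
  have h1 := (memLp_laguerre hα n).integrable_sq
  have h2 := hg.integrable_norm_pow two_ne_zero
  have e := integral_laguerre_mul_laguerre hα n n
  rw [if_pos rfl] at e
  rw [← e]
  simp only [← sq]
  rw [← integral_add h1 (by exact_mod_cast h2)]
  refine integral_mono (integrable_laguerre_smul hα hg n).norm
    (h1.add (by exact_mod_cast h2)) fun t => ?_
  simp only [norm_smul, Real.norm_eq_abs]
  nlinarith [sq_nonneg (|laguerre α n t| - ‖g t‖), sq_abs (laguerre α n t),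
    sq_nonneg (laguerre α n t), sq_nonneg ‖g t‖]

theorem summable_norm_laguerreCoef {α : ℝ} (hα : 0 < α) {g : ℝ → E}
    (hg : MemLp g 2 (laguerreMeasure α)) {r : ℝ} (h0 : 0 ≤ r) (hr : r < 1) :
    Summable fun n => r ^ n * ∫ t, ‖laguerre α n t • g t‖ ∂(laguerreMeasure α) := by
  refine Summable.of_nonneg_of_le (fun n => by positivity)
    (fun n => mul_le_mul_of_nonneg_left (integral_norm_laguerre_smul_le hα hg n) (by positivity)) ?_
  simp only [mul_add]
  exact (summable_binomCoef (by positivity) h0 hr).add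
    ((summable_geometric_of_lt_one h0 hr).mul_right _)

variable [NormedSpace ℂ E] [IsScalarTower ℝ ℂ E]

/-- The Laguerre expansion of the kernel of the transform, integrated against a square integrable
function. -/
theorem hasSum_laguerreCoef {α : ℝ} (hα : 0 < α) {g : ℝ → E}
    (hg : MemLp g 2 (laguerreMeasure α)) {w : ℂ} (hw : ‖w‖ < 1) :
    HasSum (fun n : ℕ => w ^ n • ∫ t, laguerre α n t • g t ∂(laguerreMeasure α))
      ((1 - w) ^ (-((α + 1 : ℝ) : ℂ)) •
        ∫ t : ℝ, Complex.exp (t * (w / (w - 1))) • g t ∂(laguerreMeasure α)) := by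
  have hF (n : ℕ) (t : ℝ) : (w ^ n * (laguerre α n t : ℂ)) • g t =
      w ^ n • (laguerre α n t • g t) := by
    rw [mul_smul]
    congr 1
    rw [← algebraMap_smul ℂ (laguerre α n t) (g t)]
    rfl
  have h := hasSum_integral_of_summable_integral_norm (μ := laguerreMeasure α)
    (F := fun n t => (w ^ n * (laguerre α n t : ℂ)) • g t) (fun n => ?_) ?_
  · have e (t : ℝ) := ((hasSum_laguerre hα t hw).smul_const (g t)).tsum_eq
    simp only [e] at h
    simp only [hF, mul_smul, integral_smul] at h
    exact h
  · simp only [hF]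
    exact (integrable_laguerre_smul hα hg n).smul (w ^ n)
  · simp only [hF, norm_smul (w ^ _), integral_const_mul, norm_pow]
    exact summable_norm_laguerreCoef hα hg (norm_nonneg w) hw

end Expansion

/-- The Laguerre polynomials are complete. -/
theorem ae_eq_zero_of_laguerreCoef_eq_zero {α : ℝ} (hα : 0 < α) {g : ℝ → ℝ}
    (hg : MemLp g 2 (laguerreMeasure α))
    (h0 : ∀ n, ∫ t, laguerre α n t • g t ∂(laguerreMeasure α) = 0) :
    g =ᵐ[laguerreMeasure α] 0 := by
  have := isFiniteMeasure_laguerreMeasure hα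
  set μ := laguerreMeasure α
  have hgi : Integrable g μ := hg.integrable one_le_two
  have hga : AEMeasurable g μ := hgi.aemeasurable
  have hga' : AEMeasurable (fun t => -g t) μ := hga.neg
  have hgc : MemLp (fun t => (g t : ℂ)) 2 μ := hg.ofReal
  -- The map `s ↦ s/(s-1)` is an involution sending the imaginary axis into the unit disc. Taking `w
  -- = s/(s-1)` with `s = iy` turns the kernel into `exp(ity)`, so vanishing coefficients force the
  -- Fourier transform of `g` to vanish.
  have hchar (y : ℝ) : ∫ t : ℝ, (g t : ℂ) * Complex.exp (y * t * Complex.I) ∂μ = 0 := by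
    set s : ℂ := y * Complex.I
    have hs1 : s - 1 ≠ 0 := by
      intro h
      have := congrArg Complex.re h
      simp [s] at this
    have hw : ‖s / (s - 1)‖ < 1 := by
      rw [norm_div, div_lt_one (norm_pos_iff.mpr hs1)]
      rw [← sq_lt_sq₀ (norm_nonneg _) (norm_nonneg _), ← Complex.normSq_eq_norm_sq,
        ← Complex.normSq_eq_norm_sq]
      simp [s, Complex.normSq_apply]
    have hww : s / (s - 1) / (s / (s - 1) - 1) = s := by
      rw [div_sub_one hs1, div_div_div_cancel_right₀ hs1]
      simp
    have h := hasSum_laguerreCoef hα hgc hw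
    have hz (n : ℕ) : ∫ t, laguerre α n t • (g t : ℂ) ∂μ = 0 := by
      have := congrArg Complex.ofReal (h0 n)
      rw [← integral_complex_ofReal] at this
      simpa using this
    simp only [μ] at hz
    simp only [hz, smul_zero] at h
    have h3 := h.unique hasSum_zero
    rw [hww, smul_eq_zero] at h3
    rcases h3 with h3 | h3
    · exfalso
      rw [Complex.cpow_eq_zero_iff] at h3
      rw [← sub_eq_zero.mp h3.1, norm_one] at hw
      exact lt_irrefl _ hw
    · rw [← h3]
      congr 1
      funext t
      rw [smul_eq_mul, mul_comm]
      congr 2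
      simp only [s]
      ring
  have hfin (f : ℝ → ℝ) (hf : Integrable f μ) :
      IsFiniteMeasure (μ.withDensity fun t => ENNReal.ofReal (f t)) :=
    isFiniteMeasure_withDensity_ofReal hf.2
  have := hfin g hgi
  have := hfin (fun t => -g t) hgi.neg
  have hb (y : ℝ) : ∀ᵐ t : ℝ ∂μ, ‖Complex.exp (y * t * Complex.I)‖ ≤ 1 := by
    filter_upwards with t
    rw [← Complex.ofReal_mul, Complex.norm_exp_ofReal_mul_I]
  have hint (f : ℝ → ℝ) (hf : Integrable f μ) (y : ℝ) : Integrable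
      (fun t : ℝ => (ENNReal.ofReal (f t)).toReal • Complex.exp (y * t * Complex.I)) μ := by
    have h1 : Integrable (fun t => (ENNReal.ofReal (f t)).toReal) μ := hf.pos_part
    exact h1.smul_of_top_left (memLp_top_of_bound (by fun_prop) 1 (hb y))
  -- The positive and negative parts of `g` are densities of two finite measures whose
  -- characteristic functions differ by the transform in `hchar`, hence coincide.
  have heq : (μ.withDensity fun t => ENNReal.ofReal (g t)) =
      μ.withDensity fun t => ENNReal.ofReal (-g t) := by
    apply Measure.ext_of_charFun
    funext y
    rw [charFun_apply_real, charFun_apply_real,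
      integral_withDensity_eq_integral_toReal_smul₀ hga.ennreal_ofReal (by simp),
      integral_withDensity_eq_integral_toReal_smul₀ hga'.ennreal_ofReal (by simp),
      ← sub_eq_zero, ← integral_sub (hint g hgi y) (hint (fun t => -g t) hgi.neg y), ← hchar y]
    congr 1
    funext t
    rw [← sub_smul, Complex.real_smul]
    congr 2
    rw [ENNReal.toReal_ofReal', ENNReal.toReal_ofReal']
    rcases le_total 0 (g t) with h | h
    · rw [max_eq_left h, max_eq_right (by linarith), sub_zero]
    · rw [max_eq_right h, max_eq_left (by linarith)]; ring
  rw [withDensity_eq_iff_of_sigmaFinite hga.ennreal_ofReal hga'.ennreal_ofReal] at heq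
  filter_upwards [heq] with t ht
  rcases lt_trichotomy (g t) 0 with h | h | h
  · rw [ENNReal.ofReal_of_nonpos h.le] at ht
    have := ENNReal.ofReal_eq_zero.mp ht.symm
    linarith
  · exact h
  · rw [ENNReal.ofReal_of_nonpos (p := -g t) (by linarith)] at ht
    have := ENNReal.ofReal_eq_zero.mp ht
    linarith

/-! ### The power series of the transform -/

/-- The kernel of the transform on a slice. -/
theorem exp_smul_div_sliceEmb {R : ℝ} (hR : 0 < R) (J : ℍ[ℝ]) (hJ : J * J = -1) (z : ℂ) (t : ℝ) :
    NormedSpace.exp (t • (sliceEmb J hJ z / (sliceEmb J hJ z - (R : ℍ[ℝ])))) =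
      sliceEmb J hJ (Complex.exp (t * (z / R / (z / R - 1)))) := by
  have hR' : (R : ℂ) ≠ 0 := by exact_mod_cast hR.ne'
  rw [← sliceEmb_ofReal J hJ R, ← map_sub, div_eq_mul_inv, ← map_inv₀, ← map_mul, ← map_smul,
    exp_sliceEmb, Complex.real_smul, div_sub_one hR', div_div_div_cancel_right₀ hR', div_eq_mul_inv]

theorem norm_div_lt_one_of_sliceEmb_mem {R : ℝ} (hR : 0 < R) {J : ℍ[ℝ]} {hJ : J * J = -1} {z : ℂ}
    (hz : sliceEmb J hJ z ∈ qBall R) : ‖z / R‖ < 1 := by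
  rw [mem_ball_zero_iff, norm_sliceEmb] at hz
  rw [norm_div, Complex.norm_real, Real.norm_of_nonneg hR.le, div_lt_one hR]
  exact hz

theorem integrable_bargmann_integrand {α R : ℝ} (hα : 0 < α) (hR : 0 < R) {φ : ℝ → ℍ[ℝ]}
    (hφ : MemLp φ 2 (laguerreMeasure α)) {q : ℍ[ℝ]} (hq : q ∈ qBall R) :
    Integrable (fun t : ℝ => NormedSpace.exp (t • (q / (q - (R : ℍ[ℝ])))) * φ t)
      (laguerreMeasure α) := by
  obtain ⟨J, hJ, z, rfl⟩ := exists_sliceEmb_eq q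
  simp only [exp_smul_div_sliceEmb hR]
  have h := memLp_cexp hα (re_div_sub_one_lt (norm_div_lt_one_of_sliceEmb_mem hR hq))
  have h2 : MemLp (fun t : ℝ => sliceEmb J hJ (Complex.exp (t * (z / R / (z / R - 1))))) 2
      (laguerreMeasure α) := by
    refine h.of_le ((continuous_sliceEmb J hJ).comp_aestronglyMeasurable h.1) ?_
    filter_upwards with t
    rw [norm_sliceEmb]
  exact h2.integrable_mul hφ

/-- The coefficients of a function against the Laguerre polynomials. -/
noncomputable def laguerreCoef (α : ℝ) (φ : ℝ → ℍ[ℝ]) (n : ℕ) : ℍ[ℝ] :=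
  ∫ t, laguerre α n t • φ t ∂(laguerreMeasure α)

/-- The power series expansion of the transform. -/
theorem hasSum_bargmann {α R : ℝ} (hα : 0 < α) (hR : 0 < R) {φ : ℝ → ℍ[ℝ]}
    (hφ : MemLp φ 2 (laguerreMeasure α)) {q : ℍ[ℝ]} (hq : q ∈ qBall R) :
    HasSum (fun n : ℕ => (q / (R : ℍ[ℝ])) ^ n * laguerreCoef α φ n) (bargmann α R φ q) := by
  obtain ⟨J, hJ, z, rfl⟩ := exists_sliceEmb_eq q
  have hw := norm_div_lt_one_of_sliceEmb_mem hR hq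
  have hq' : sliceEmb J hJ z / (R : ℍ[ℝ]) = sliceEmb J hJ (z / R) := by
    rw [← sliceEmb_ofReal J hJ R, div_eq_mul_inv, ← map_inv₀, ← map_mul, div_eq_mul_inv]
  -- The complex structure on `ℍ` depends on the slice of `q`, so it is supplied explicitly; its
  -- scalar action is left multiplication, definitionally.
  have h := @hasSum_laguerreCoef ℍ[ℝ] _ _ (sliceNormedSpace J hJ)
    (sliceNormedSpace_isScalarTower J hJ) α hα φ hφ _ hw
  -- On the right half-plane the quaternionic principal power is the complex one.
  have hre : 0 < (1 - z / R).re := by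
    have := (abs_le.mp (Complex.abs_re_le_norm (z / R))).2
    rw [Complex.sub_re, Complex.one_re]
    linarith
  have hb : bargmann α R φ (sliceEmb J hJ z) =
      sliceEmb J hJ ((1 - z / R) ^ (-((α + 1 : ℝ) : ℂ))) * ∫ t : ℝ,
        sliceEmb J hJ (Complex.exp (t * (z / R / (z / R - 1)))) * φ t ∂(laguerreMeasure α) := by
    unfold bargmann
    rw [hq', ← map_one (sliceEmb J hJ), ← map_sub, qPow_sliceEmb J hJ hre]
    simp only [exp_smul_div_sliceEmb hR]
    rw [show ((-α - 1 : ℝ) : ℂ) = -((α + 1 : ℝ) : ℂ) by push_cast; ring]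
  rw [hb]
  refine HasSum.congr_fun (show HasSum
    (fun n => sliceEmb J hJ ((z / R) ^ n) * laguerreCoef α φ n) _ from h) fun n => ?_
  rw [hq', map_pow]

/-! ### Cauchy–Riemann equations and complex derivatives -/

section CauchyRiemann

variable {E : Type*} [NormedAddCommGroup E] [NormedSpace ℝ E] [NormedSpace ℂ E]
  [IsScalarTower ℝ ℂ E]

theorem hasDerivAt_of_cauchyRiemann {F : ℝ × ℝ → E} {L : ℝ × ℝ →L[ℝ] E} {z : ℂ}
    (hF : HasFDerivAt F L (z.re, z.im)) (hCR : L (0, 1) = Complex.I • L (1, 0)) :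
    HasDerivAt (fun z : ℂ => F (z.re, z.im)) (L (1, 0)) z := by
  have h : HasFDerivAt (fun z : ℂ => F (z.re, z.im))
      (L.comp (Complex.equivRealProdCLM : ℂ →L[ℝ] ℝ × ℝ)) z :=
    HasFDerivAt.comp z (g := F) (f := fun z : ℂ => (z.re, z.im)) hF
      Complex.equivRealProdCLM.hasFDerivAt
  rw [hasDerivAt_iff_hasFDerivAt]
  refine hasFDerivAt_of_restrictScalars ℝ h ?_
  ext w
  have e : ((w.re, w.im) : ℝ × ℝ) = w.re • (1, 0) + w.im • (0, 1) := by simp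
  simp only [ContinuousLinearMap.coe_restrictScalars', ContinuousLinearMap.toSpanSingleton_apply,
    ContinuousLinearMap.comp_apply, ContinuousLinearEquiv.coe_coe,
    Complex.equivRealProdCLM_apply]
  rw [e, map_add, map_smul, map_smul, hCR, ← algebraMap_smul ℂ w.re, ← algebraMap_smul ℂ w.im,
    smul_smul, ← add_smul]
  congr 1
  exact (Complex.re_add_im w).symm

theorem exists_hasFDerivAt_of_hasDerivAt {G : ℂ → E} {d : E} {p : ℝ × ℝ}
    (h : HasDerivAt G d ⟨p.1, p.2⟩) :
    ∃ L : ℝ × ℝ →L[ℝ] E, HasFDerivAt (fun p : ℝ × ℝ => G ⟨p.1, p.2⟩) L p ∧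
      L (1, 0) = d ∧ L (0, 1) = Complex.I • d := by
  refine ⟨_, HasFDerivAt.comp p (g := G) (f := fun p : ℝ × ℝ => (⟨p.1, p.2⟩ : ℂ))
    (h.hasFDerivAt.restrictScalars ℝ) Complex.equivRealProdCLM.symm.hasFDerivAt, ?_, ?_⟩
  · have e : (Complex.equivRealProdCLM.symm (1, 0)) = 1 := by apply Complex.ext <;> simp
    simp [e]
  · have e : (Complex.equivRealProdCLM.symm (0, 1)) = Complex.I := by apply Complex.ext <;> simp
    simp [e]

end CauchyRiemann

theorem sliceEmb_I (J : ℍ[ℝ]) (hJ : J * J = -1) : sliceEmb J hJ Complex.I = J :=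
  Complex.liftAux_apply_I J hJ

theorem sliceEmb_mem_qBall {R : ℝ} {J : ℍ[ℝ]} {hJ : J * J = -1} {z : ℂ} :
    sliceEmb J hJ z ∈ qBall R ↔ z ∈ Metric.ball (0 : ℂ) R := by
  rw [mem_ball_zero_iff, mem_ball_zero_iff, norm_sliceEmb]

/-! ### Slice regular functions as power series -/

section PowerSeries

variable {R : ℝ} {f : ℍ[ℝ] → ℍ[ℝ]} {a : ℕ → ℍ[ℝ]}

theorem summable_norm_of_hasSum_qBall
    (hf : ∀ q ∈ qBall R, HasSum (fun n => q ^ n * a n) (f q)) {r : ℝ} (h0 : 0 ≤ r) (hr : r < R) :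
    Summable fun n => r ^ n * ‖a n‖ := by
  -- Evaluate at the real point `r`; in finite dimension, summability is absolute.
  have h := (hf (r : ℍ[ℝ]) (by simpa [abs_of_nonneg h0] using hr)).summable.norm
  refine h.congr fun n => ?_
  rw [norm_mul, norm_pow, Quaternion.norm_coe, Real.norm_of_nonneg h0]

/-- The term `qⁿ aₙ` is the diagonal of the multilinear map `(q₁, …, qₙ) ↦ q₁ ⋯ qₙ aₙ`, of norm at
most `|aₙ|`. This gives differentiability in all four real variables, which holomorphy on slices
alone does not. -/
theorem analyticOnNhd_of_hasSum (hR : 0 < R)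
    (hf : ∀ q ∈ qBall R, HasSum (fun n => q ^ n * a n) (f q)) :
    AnalyticOnNhd ℝ f (qBall R) := by
  let p : FormalMultilinearSeries ℝ ℍ[ℝ] ℍ[ℝ] := fun n =>
    ((ContinuousLinearMap.mul ℝ ℍ[ℝ]).flip (a n)).compContinuousMultilinearMap
      (ContinuousMultilinearMap.mkPiAlgebraFin ℝ n ℍ[ℝ])
  have hp (n : ℕ) : ‖p n‖ ≤ ‖a n‖ := by
    refine ContinuousMultilinearMap.opNorm_le_bound (norm_nonneg _) fun m => ?_
    simp only [p, ContinuousLinearMap.compContinuousMultilinearMap_coe, Function.comp,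
      ContinuousLinearMap.flip_apply, ContinuousLinearMap.mul_apply',
      ContinuousMultilinearMap.mkPiAlgebraFin_apply, norm_mul]
    rw [mul_comm]
    gcongr
    rw [← List.prod_ofFn]
    refine (List.norm_prod_le _).trans (le_of_eq ?_)
    rw [List.map_ofFn]
    rfl
  have hrad : ENNReal.ofReal R ≤ p.radius := by
    refine ENNReal.le_of_forall_nnreal_lt fun r hr => ?_
    apply p.le_radius_of_summable_norm
    have hr' : (r : ℝ) < R := by
      rwa [ENNReal.lt_ofReal_iff_toReal_lt ENNReal.coe_ne_top, ENNReal.coe_toReal] at hr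
    refine Summable.of_nonneg_of_le (fun n => by positivity) (fun n => ?_)
      (summable_norm_of_hasSum_qBall hf r.2 hr')
    rw [mul_comm]
    exact mul_le_mul_of_nonneg_left (hp n) (by positivity)
  have hpos : 0 < ENNReal.ofReal R := ENNReal.ofReal_pos.mpr hR
  have h := ((p.hasFPowerSeriesOnBall (hpos.trans_le hrad)).mono hpos hrad).analyticOnNhd
  rw [Metric.eball_ofReal] at h
  refine h.congr Metric.isOpen_ball fun q hq => ?_
  rw [← (hf q hq).tsum_eq]
  refine tsum_congr fun n => ?_
  simp [p]

theorem differentiableAt_sliceEmb_of_hasSum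
    (hf : ∀ q ∈ qBall R, HasSum (fun n => q ^ n * a n) (f q)) (J : ℍ[ℝ]) (hJ : J * J = -1)
    {z : ℂ} (hz : z ∈ Metric.ball (0 : ℂ) R) :
    @DifferentiableAt ℂ _ ℂ _ _ _ ℍ[ℝ] _ (sliceNormedSpace J hJ).toModule _
      (fun z => f (sliceEmb J hJ z)) z := by
  let := sliceNormedSpace J hJ
  rw [mem_ball_zero_iff] at hz
  obtain ⟨r, hzr, hrR⟩ := exists_between hz
  have h0 : 0 ≤ r := (norm_nonneg z).trans hzr.le
  have hd : DifferentiableOn ℂ (fun z : ℂ => ∑' n, z ^ n • a n) (Metric.ball 0 r) := by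
    refine Complex.differentiableOn_tsum_of_summable_norm (summable_norm_of_hasSum_qBall hf h0 hrR)
      (fun n => ?_) Metric.isOpen_ball fun n w hw => ?_
    · exact ((differentiable_id.pow n).smul_const (a n)).differentiableOn
    · rw [norm_smul, norm_pow]
      rw [mem_ball_zero_iff] at hw
      gcongr
  have hzm : Metric.ball (0 : ℂ) r ∈ nhds z :=
    Metric.isOpen_ball.mem_nhds (mem_ball_zero_iff.mpr hzr)
  refine (hd.differentiableAt hzm).congr_of_eventuallyEq ?_
  filter_upwards [hzm] with w hw
  have hwR : sliceEmb J hJ w ∈ qBall R :=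
    sliceEmb_mem_qBall.mpr (Metric.ball_subset_ball hrR.le hw)
  rw [← (hf _ hwR).tsum_eq]
  refine tsum_congr fun n => ?_
  rw [← map_pow]
  rfl

theorem sliceFun_eq (f : ℍ[ℝ] → ℍ[ℝ]) (J : ℍ[ℝ]) (hJ : J * J = -1) :
    sliceFun f J = fun p : ℝ × ℝ => f (sliceEmb J hJ ⟨p.1, p.2⟩) := by
  funext p
  rw [sliceEmb_eq_slicePt]
  rfl

/-- Convergent power series with coefficients on the right are slice regular. -/
theorem isSliceRegularOn_of_hasSum (hR : 0 < R)
    (hf : ∀ q ∈ qBall R, HasSum (fun n => q ^ n * a n) (f q)) :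
    IsSliceRegularOn f (qBall R) := by
  have han := analyticOnNhd_of_hasSum hR hf
  refine ⟨han.differentiableOn, fun J hJ => ⟨?_, fun p hp => ?_⟩⟩
  · have h1 : ContDiffOn ℝ 1 f (qBall R) := han.contDiffOn Metric.isOpen_ball.uniqueDiffOn
    refine h1.comp (ContDiff.contDiffOn ?_) fun p hp => hp
    unfold slicePt
    have hc : ContDiff ℝ 1 (fun x : ℝ => (x : ℍ[ℝ])) :=
      (Algebra.linearMap ℝ ℍ[ℝ]).toContinuousLinearMap.contDiff
    exact (hc.comp contDiff_fst).add ((hc.comp contDiff_snd).mul contDiff_const)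
  · let := sliceNormedSpace J hJ
    have := sliceNormedSpace_isScalarTower J hJ
    have hz : (⟨p.1, p.2⟩ : ℂ) ∈ Metric.ball (0 : ℂ) R := by
      rw [← sliceEmb_mem_qBall (J := J) (hJ := hJ), sliceEmb_eq_slicePt]
      exact hp
    obtain ⟨L, hL, h1, h2⟩ := exists_hasFDerivAt_of_hasDerivAt
      (differentiableAt_sliceEmb_of_hasSum hf J hJ hz).hasDerivAt
    rw [dbar, sliceFun_eq f J hJ, hL.fderiv, h2, h1]
    change (1 / 2 : ℝ) • (_ + J * (sliceEmb J hJ Complex.I * _)) = 0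
    rw [sliceEmb_I, ← mul_assoc, hJ, neg_one_mul, add_neg_cancel, smul_zero]

/-- The Cauchy–Riemann equation is holomorphy on the slice for the complex structure of `J`, so the
Taylor series converges on the whole disc. At this stage the coefficients may depend on `J`. -/
theorem hasSum_taylor_sliceEmb (hf : IsSliceRegularOn f (qBall R)) (J : ℍ[ℝ])
    (hJ : J * J = -1) : ∃ b : ℕ → ℍ[ℝ], ∀ z ∈ Metric.ball (0 : ℂ) R,
      HasSum (fun n => sliceEmb J hJ z ^ n * b n) (f (sliceEmb J hJ z)) := by
  let := sliceNormedSpace J hJ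
  have := sliceNormedSpace_isScalarTower J hJ
  have hd : DifferentiableOn ℂ (fun z => f (sliceEmb J hJ z)) (Metric.ball (0 : ℂ) R) := by
    intro z hz
    have hz' : slicePt J z.re z.im ∈ qBall R := by
      rw [← sliceEmb_eq_slicePt J hJ]
      exact sliceEmb_mem_qBall.mpr hz
    have hF := (((hf.2 J hJ).1.differentiableOn one_ne_zero).differentiableAt
      ((isOpen_slice Metric.isOpen_ball J).mem_nhds
        (x := (z.re, z.im)) hz')).hasFDerivAt
    have hc := (hf.2 J hJ).2 (z.re, z.im) hz'
    rw [dbar, smul_eq_zero_iff_right (by norm_num)] at hc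
    have h := hasDerivAt_of_cauchyRiemann hF (by
      change _ = sliceEmb J hJ Complex.I * _
      rw [sliceEmb_I, eq_neg_of_add_eq_zero_left hc, mul_neg, ← mul_assoc, hJ]
      simp)
    rw [sliceFun_eq f J hJ] at h
    exact h.differentiableAt.differentiableWithinAt
  refine ⟨fun n => ((n.factorial : ℂ)⁻¹) • iteratedDeriv n (fun z => f (sliceEmb J hJ z)) 0,
    fun z hz => ?_⟩
  have h := Complex.hasSum_taylorSeries_on_ball hd hz
  refine h.congr_fun fun n => ?_
  rw [sub_zero, smul_comm, ← map_pow]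
  rfl

/-- The real axis is common to all slices, so uniqueness there identifies the Taylor coefficients of
different slices. -/
theorem coeff_unique_of_hasSum_real (hR : 0 < R) {F : ℝ → ℍ[ℝ]} {b : ℕ → ℍ[ℝ]}
    (ha : ∀ x : ℝ, |x| < R → HasSum (fun n => x ^ n • a n) (F x))
    (hb : ∀ x : ℝ, |x| < R → HasSum (fun n => x ^ n • b n) (F x)) : a = b := by
  let P (c : ℕ → ℍ[ℝ]) : FormalMultilinearSeries ℝ ℝ ℍ[ℝ] :=
    fun n => ContinuousMultilinearMap.mkPiRing ℝ (Fin n) (c n)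
  have key (c : ℕ → ℍ[ℝ]) (hc : ∀ x : ℝ, |x| < R → HasSum (fun n => x ^ n • c n) (F x)) :
      HasFPowerSeriesAt F (P c) 0 := by
    refine hasFPowerSeriesAt_iff.mpr ?_
    filter_upwards [Metric.ball_mem_nhds (0 : ℝ) hR] with x hx
    rw [mem_ball_zero_iff] at hx
    simpa [FormalMultilinearSeries.coeff, P] using hc x hx
  have h := (key a ha).eq_formalMultilinearSeries (key b hb)
  funext n
  have := congrArg (fun p => FormalMultilinearSeries.coeff p n) h
  simpa [FormalMultilinearSeries.coeff, P] using this

/-- Slice regular functions on a ball are sums of power series. -/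
theorem IsSliceRegularOn.exists_hasSum (hR : 0 < R) (hf : IsSliceRegularOn f (qBall R)) :
    ∃ a : ℕ → ℍ[ℝ], ∀ q ∈ qBall R, HasSum (fun n => q ^ n * a n) (f q) := by
  choose b hb using hasSum_taylor_sliceEmb hf
  have hreal (J : ℍ[ℝ]) (hJ : J * J = -1) (x : ℝ) (hx : |x| < R) :
      HasSum (fun n => x ^ n • b J hJ n) (f (x : ℍ[ℝ])) := by
    have h := hb J hJ (x : ℂ) (by simpa using hx)
    rw [sliceEmb_ofReal] at h
    refine h.congr_fun fun n => ?_
    rw [← Quaternion.coe_mul_eq_smul, Quaternion.coe_pow]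
  obtain ⟨J₀, hJ₀, -⟩ := exists_sliceEmb_eq 0
  refine ⟨b J₀ hJ₀, fun q hq => ?_⟩
  obtain ⟨J, hJ, z, rfl⟩ := exists_sliceEmb_eq q
  rw [coeff_unique_of_hasSum_real hR (hreal J₀ hJ₀) (hreal J hJ)]
  exact hb J hJ z (sliceEmb_mem_qBall.mp hq)

end PowerSeries

/-! ### The slice norm of a power series: Parseval and the Beta integral -/

theorem quaternion_re_mul_comm (a b : ℍ[ℝ]) : (a * b).re = (b * a).re := by
  simp only [Quaternion.re_mul]
  ring

/-- The real part of a quaternion, as a continuous linear map. -/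
noncomputable def reCLM : ℍ[ℝ] →L[ℝ] ℝ := innerSL ℝ 1

theorem reCLM_apply (q : ℍ[ℝ]) : reCLM q = q.re := by
  rw [reCLM, innerSL_apply_apply, Quaternion.inner_def, one_mul, Quaternion.re_star]

theorem abs_re_le_norm (q : ℍ[ℝ]) : |q.re| ≤ ‖q‖ := by
  have h := abs_real_inner_le_norm (1 : ℍ[ℝ]) q
  rwa [norm_one, one_mul, ← innerSL_apply_apply, ← reCLM, reCLM_apply] at h

theorem norm_sq_eq_re_mul_star (a : ℍ[ℝ]) : ‖a‖ ^ 2 = (a * star a).re := by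
  rw [Quaternion.self_mul_star, Quaternion.re_coe, Quaternion.normSq_eq_norm_mul_self, sq]

theorem setIntegral_cexp_circle {k : ℤ} (hk : k ≠ 0) :
    ∫ θ : ℝ in Set.Ioo (-Real.pi) Real.pi, Complex.exp (k * Complex.I * θ) = 0 := by
  rw [← integral_Ioc_eq_integral_Ioo, ← intervalIntegral.integral_of_le
    (by linarith [Real.pi_pos]), integral_exp_mul_complex (by simpa using hk)]
  have e : (k : ℂ) * Complex.I * Real.pi = k * Complex.I * (-Real.pi : ℝ) +
      k * (2 * Real.pi * Complex.I) := by push_cast; ring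
  rw [e, Complex.exp_periodic.int_mul k, sub_self, zero_div]

/-- **Parseval's identity** on a circle, for quaternionic power series. -/
theorem hasSum_integral_circle (J : ℍ[ℝ]) (hJ : J * J = -1) {c : ℕ → ℍ[ℝ]}
    (hc : Summable fun n => ‖c n‖) :
    HasSum (fun n => 2 * Real.pi * ‖c n‖ ^ 2)
      (∫ θ : ℝ in Set.Ioo (-Real.pi) Real.pi,
        ‖∑' n : ℕ, sliceEmb J hJ (Complex.exp (n * Complex.I * θ)) * c n‖ ^ 2) := by
  set x : ℕ → ℝ → ℍ[ℝ] := fun n θ => sliceEmb J hJ (Complex.exp (n * Complex.I * θ)) * c n with hx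
  have hcont (n : ℕ) : Continuous (x n) :=
    ((continuous_sliceEmb J hJ).comp (by fun_prop)).mul continuous_const
  have hnx (n : ℕ) (θ : ℝ) : ‖x n θ‖ = ‖c n‖ := by
    rw [hx, norm_mul, norm_sliceEmb, show (n : ℂ) * Complex.I * θ = (n * θ : ℝ) * Complex.I by
      push_cast; ring, Complex.norm_exp_ofReal_mul_I, one_mul]
  have hxs (θ : ℝ) : Summable fun n => ‖x n θ‖ := by simpa only [hnx] using hc
  have hxs' (θ : ℝ) : Summable fun n => ‖star (x n θ)‖ := by simpa only [norm_star] using hxs θ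
  -- These are the terms of the double series for `|∑ xₙ|²`; they are dominated by `‖cₘ‖ ‖cₙ‖`, so
  -- the series can be integrated term by term.
  set f : ℕ × ℕ → ℝ → ℝ := fun p θ => (x p.1 θ * star (x p.2 θ)).re
  have hfc (p : ℕ × ℕ) : Continuous (f p) :=
    Quaternion.continuous_re.comp ((hcont p.1).mul (continuous_star.comp (hcont p.2)))
  have hfsum (θ : ℝ) : HasSum (fun p => f p θ) (‖∑' n, x n θ‖ ^ 2) := by
    have h1 := (summable_mul_of_summable_norm (hxs θ) (hxs' θ)).hasSum
    rw [← tsum_mul_tsum_of_summable_norm (hxs θ) (hxs' θ), ← tsum_star] at h1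
    rw [norm_sq_eq_re_mul_star, ← reCLM_apply]
    refine (reCLM.hasSum h1).congr_fun fun p => ?_
    exact (reCLM_apply _).symm
  have hfb (p : ℕ × ℕ) (θ : ℝ) : ‖f p θ‖ ≤ ‖c p.1‖ * ‖c p.2‖ := by
    rw [← hnx p.1 θ, ← hnx p.2 θ, ← norm_star (x p.2 θ), ← norm_mul]
    exact abs_re_le_norm _
  have hfi (p : ℕ × ℕ) : IntegrableOn (f p) (Set.Ioo (-Real.pi) Real.pi) :=
    ((hfc p).integrableOn_Icc).mono_set Set.Ioo_subset_Icc_self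
  have hmain := hasSum_integral_of_summable_integral_norm hfi (by
    refine Summable.of_nonneg_of_le (fun p => by positivity) (fun p => ?_)
      ((hc.mul_of_nonneg hc (fun _ => norm_nonneg _) (fun _ => norm_nonneg _)).mul_left
        (2 * Real.pi))
    refine (integral_mono (hfi p).norm (integrable_const _) (hfb p)).trans (le_of_eq ?_)
    simp [Real.pi_pos.le, two_mul])
  simp only [fun θ => (hfsum θ).tsum_eq] at hmain
  refine hmain.prod_fiberwise fun m => ?_
  have hval (n : ℕ) : ∫ θ in Set.Ioo (-Real.pi) Real.pi, f (m, n) θ =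
      if n = m then 2 * Real.pi * ‖c m‖ ^ 2 else 0 := by
    split_ifs with h
    · subst h
      simp only [f, ← norm_sq_eq_re_mul_star, hnx]
      simp [Real.pi_pos.le, two_mul]
    -- The exponentials are separated by `cₘ star cₙ`, but the real part is invariant under cyclic
    -- permutation. This brings them together as `e^(i(m-n)θ)`, to which a fixed real-linear map is
    -- applied.
    · let T : ℂ →L[ℝ] ℝ := (reCLM.toLinearMap ∘ₗ LinearMap.mulRight ℝ (c m * star (c n)) ∘ₗ
        (sliceEmb J hJ).toLinearMap).toContinuousLinearMap
      have hT (θ : ℝ) : f (m, n) θ = T (Complex.exp (((m : ℤ) - n : ℤ) * Complex.I * θ)) := by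
        change _ = reCLM (sliceEmb J hJ _ * (c m * star (c n)))
        rw [reCLM_apply]
        simp only [f, hx, star_mul, star_sliceEmb]
        rw [← mul_assoc, quaternion_re_mul_comm, ← mul_assoc, ← mul_assoc, ← map_mul, mul_assoc]
        congr 3
        have : star (Complex.exp (n * Complex.I * θ)) = Complex.exp (-(n * Complex.I * θ)) := by
          rw [Complex.star_def, ← Complex.exp_conj]
          simp
        rw [this, ← Complex.exp_add]
        congr 1
        push_cast
        ring
      simp only [hT]
      rw [ContinuousLinearMap.integral_comp_comm, setIntegral_cexp_circle, map_zero]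
      · rw [sub_ne_zero]
        exact_mod_cast Ne.symm h
      · exact (Continuous.integrableOn_Icc (by fun_prop)).mono_set Set.Ioo_subset_Icc_self
  simp only [hval]
  exact hasSum_ite_eq m _

theorem enorm_sq_eq_ofReal (q : ℍ[ℝ]) : ‖q‖ₑ ^ 2 = ENNReal.ofReal (‖q‖ ^ 2) := by
  rw [← ofReal_norm, ENNReal.ofReal_pow (norm_nonneg q)]

/-- With values in `ℝ≥0∞`, the later integration in the radius commutes with the sum even when the
slice norm is not known to be finite. -/
theorem lintegral_circle (J : ℍ[ℝ]) (hJ : J * J = -1) {c : ℕ → ℍ[ℝ]}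
    (hc : Summable fun n => ‖c n‖) :
    ∫⁻ θ : ℝ in Set.Ioo (-Real.pi) Real.pi,
        ‖∑' n : ℕ, sliceEmb J hJ (Complex.exp (n * Complex.I * θ)) * c n‖ₑ ^ 2 =
      ∑' n, ENNReal.ofReal (2 * Real.pi) * ‖c n‖ₑ ^ 2 := by
  have h := hasSum_integral_circle J hJ hc
  have hcont : Continuous fun θ : ℝ =>
      ∑' n : ℕ, sliceEmb J hJ (Complex.exp (n * Complex.I * θ)) * c n := by
    refine continuous_tsum (fun n =>
      ((continuous_sliceEmb J hJ).comp (by fun_prop)).mul continuous_const) hc fun n θ => ?_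
    rw [norm_mul, norm_sliceEmb, show (n : ℂ) * Complex.I * θ = (n * θ : ℝ) * Complex.I by
      push_cast; ring, Complex.norm_exp_ofReal_mul_I, one_mul]
  simp only [enorm_sq_eq_ofReal]
  rw [← ofReal_integral_eq_lintegral_ofReal, ← h.tsum_eq, ENNReal.ofReal_tsum_of_nonneg]
  · refine tsum_congr fun n => ?_
    rw [ENNReal.ofReal_mul (by positivity)]
  · intro n; positivity
  · exact h.summable
  · exact (Continuous.integrableOn_Icc (by fun_prop)).mono_set Set.Ioo_subset_Icc_self
  · filter_upwards with θ
    positivity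

/-- This is the total mass of the Beta density with parameters `n+1` and `α`, since `α B(n+1, α) =
1/bₙ`. -/
theorem lintegral_pow_mul_one_sub_rpow {α : ℝ} (hα : 0 < α) (n : ℕ) :
    ∫⁻ u in Set.Ioo (0 : ℝ) 1, ENNReal.ofReal (α * (u ^ n * (1 - u) ^ (α - 1))) =
      ENNReal.ofReal (binomCoef (α + 1) n)⁻¹ := by
  have h := ProbabilityTheory.lintegral_betaPDF_eq_one (α := (n : ℝ) + 1) (β := α)
    (by positivity) hα
  have hb := ProbabilityTheory.beta_pos (α := (n : ℝ) + 1) (β := α) (by positivity) hα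
  rw [ProbabilityTheory.lintegral_betaPDF] at h
  have e : (binomCoef (α + 1) n)⁻¹ = α * ProbabilityTheory.beta (n + 1) α := by
    rw [binomCoef, ProbabilityTheory.beta, Real.Gamma_add_one hα.ne', Real.Gamma_nat_eq_factorial,
      show α + 1 + n = n + 1 + α by ring, inv_div]
    ring
  have e2 (u : ℝ) (hu : u ∈ Set.Ioo (0 : ℝ) 1) :
      ENNReal.ofReal (α * (u ^ n * (1 - u) ^ (α - 1))) =
        ENNReal.ofReal (α * ProbabilityTheory.beta (n + 1) α) *
        ENNReal.ofReal (1 / ProbabilityTheory.beta (n + 1) α * u ^ ((n : ℝ) + 1 - 1) *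
          (1 - u) ^ (α - 1)) := by
    rw [← ENNReal.ofReal_mul (by positivity), add_sub_cancel_right, Real.rpow_natCast]
    congr 1
    field_simp
  rw [setLIntegral_congr_fun measurableSet_Ioo e2, lintegral_const_mul _ (by fun_prop), h, mul_one, e]

/-- Substitute `u = r²/R²`. The factor `r` is the polar Jacobian and `2π r^(2n)` comes from Parseval
on the circle of radius `r`. -/
theorem lintegral_radial {α R : ℝ} (hα : 0 < α) (hR : 0 < R) (n : ℕ) :
    ∫⁻ r in Set.Ioo (0 : ℝ) R, ENNReal.ofReal (r * (α / (Real.pi * R ^ 2) *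
        (1 - r ^ 2 / R ^ 2) ^ (α - 1)) * (2 * Real.pi * r ^ (2 * n))) =
      ENNReal.ofReal (R ^ (2 * n) / binomCoef (α + 1) n) := by
  have him : (fun r : ℝ => r ^ 2 / R ^ 2) '' Set.Ioo (0 : ℝ) R = Set.Ioo (0 : ℝ) 1 := by
    ext u
    constructor
    · rintro ⟨r, ⟨h0, h1⟩, rfl⟩
      refine ⟨by positivity, ?_⟩
      simp only
      rw [div_lt_one (by positivity)]
      gcongr
    · rintro ⟨h0, h1⟩
      refine ⟨R * Real.sqrt u, ⟨by positivity, ?_⟩, ?_⟩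
      · have : Real.sqrt u < 1 := by rw [Real.sqrt_lt' one_pos]; simpa using h1
        nlinarith
      · simp only
        rw [mul_pow, Real.sq_sqrt h0.le]
        field_simp
  have hinj : Set.InjOn (fun r : ℝ => r ^ 2 / R ^ 2) (Set.Ioo (0 : ℝ) R) := by
    intro x hx y hy h
    simp only at h
    rw [div_left_inj' (by positivity)] at h
    exact (pow_left_inj₀ hx.1.le hy.1.le two_ne_zero).mp h
  have hsub := lintegral_image_eq_lintegral_abs_deriv_mul (f' := fun r => 2 * r / R ^ 2)
    measurableSet_Ioo (fun x _ => by
      simpa using ((hasDerivAt_pow 2 x).div_const (R ^ 2)).hasDerivWithinAt) hinj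
    (fun u => ENNReal.ofReal (α * (u ^ n * (1 - u) ^ (α - 1))))
  rw [him, lintegral_pow_mul_one_sub_rpow hα] at hsub
  rw [div_eq_mul_inv (R ^ (2 * n)), ENNReal.ofReal_mul (by positivity), hsub, ← lintegral_const_mul _ (by fun_prop)]
  refine setLIntegral_congr_fun measurableSet_Ioo fun r hr => ?_
  have hr0 : 0 < r := hr.1
  rw [← ENNReal.ofReal_mul (by positivity), ← ENNReal.ofReal_mul (by positivity),
    abs_of_pos (by positivity)]
  congr 1
  rw [div_pow, ← pow_mul, ← pow_mul]
  field_simp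

theorem measurable_discDensity (α R : ℝ) : Measurable fun z : ℂ =>
    ENNReal.ofReal (α / (Real.pi * R ^ 2) * (1 - ‖z‖ ^ 2 / R ^ 2) ^ (α - 1)) := by
  fun_prop

theorem lintegral_discMeasure_polar (α : ℝ) {R : ℝ} {F : ℂ → ℝ≥0∞}
    (hF : ContinuousOn F (Metric.ball 0 R)) :
    ∫⁻ z, F z ∂(discMeasure α R) = ∫⁻ r in Set.Ioo (0 : ℝ) R,
      ENNReal.ofReal r * ENNReal.ofReal (α / (Real.pi * R ^ 2) *
        (1 - r ^ 2 / R ^ 2) ^ (α - 1)) *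
      ∫⁻ θ in Set.Ioo (-Real.pi) Real.pi, F (r * Complex.exp (θ * Complex.I)) := by
  set G : ℂ → ℝ≥0∞ := (Metric.ball (0 : ℂ) R).indicator fun z =>
    ENNReal.ofReal (α / (Real.pi * R ^ 2) * (1 - ‖z‖ ^ 2 / R ^ 2) ^ (α - 1)) * F z
  -- Nothing is known about `F` off the ball, so measurability is established for its extension by
  -- zero.
  have hind : Measurable ((Metric.ball (0 : ℂ) R).indicator F) := by
    refine measurable_of_restrict_of_restrict_compl (s := Metric.ball (0 : ℂ) R)
      Metric.isOpen_ball.measurableSet ?_ ?_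
    · have e : (Metric.ball (0 : ℂ) R).domRestrict ((Metric.ball (0 : ℂ) R).indicator F) =
          (Metric.ball (0 : ℂ) R).domRestrict F := funext fun x => Set.indicator_of_mem x.2 F
      rw [e]
      exact hF.domRestrict.measurable
    · have e : (Metric.ball (0 : ℂ) R)ᶜ.domRestrict ((Metric.ball (0 : ℂ) R).indicator F) =
          fun _ => 0 := funext fun x => Set.indicator_of_notMem x.2 F
      rw [e]
      exact measurable_const
  have hG : Measurable G := by
    have : G = fun z => ENNReal.ofReal (α / (Real.pi * R ^ 2) *
        (1 - ‖z‖ ^ 2 / R ^ 2) ^ (α - 1)) * (Metric.ball (0 : ℂ) R).indicator F z := by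
      funext z
      by_cases hz : z ∈ Metric.ball (0 : ℂ) R
      · simp only [G, Set.indicator_of_mem hz]
      · simp only [G, Set.indicator_of_notMem hz, mul_zero]
    rw [this]
    exact (measurable_discDensity α R).mul hind
  have h1 : ∫⁻ z, F z ∂(discMeasure α R) = ∫⁻ z, G z := by
    rw [discMeasure, lintegral_withDensity_eq_lintegral_mul_non_measurable _
      (measurable_discDensity α R) (by simp), lintegral_indicator Metric.isOpen_ball.measurableSet]
    rfl
  rw [h1, ← Complex.lintegral_comp_polarCoord_symm, polarCoord_target, Measure.volume_eq_prod,
    setLIntegral_prod]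
  · set K : ℝ → ℝ≥0∞ := fun r => ENNReal.ofReal r * ENNReal.ofReal (α / (Real.pi * R ^ 2) *
      (1 - r ^ 2 / R ^ 2) ^ (α - 1)) *
      ∫⁻ θ in Set.Ioo (-Real.pi) Real.pi, F (r * Complex.exp (θ * Complex.I))
    have hK : ∫⁻ r in Set.Ioo 0 R, K r = ∫⁻ r in Set.Ioi 0, (Set.Iio R).indicator K r := by
      rw [lintegral_indicator measurableSet_Iio, Measure.restrict_restrict measurableSet_Iio,
        Set.Iio_inter_Ioi]
    rw [hK]
    refine setLIntegral_congr_fun measurableSet_Ioi fun r hr => ?_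
    have hr0 : 0 < r := hr
    have hpt (θ : ℝ) : Complex.polarCoord.symm (r, θ) = r * Complex.exp (θ * Complex.I) := by
      rw [Complex.polarCoord_symm_apply, Complex.exp_mul_I]
      push_cast
      rfl
    have hnorm (θ : ℝ) : ‖(r * Complex.exp (θ * Complex.I) : ℂ)‖ = r := by
      rw [norm_mul, Complex.norm_exp_ofReal_mul_I, mul_one, Complex.norm_real,
        Real.norm_of_nonneg hr0.le]
    simp only [hpt, smul_eq_mul]
    by_cases hrR : r < R
    · rw [Set.indicator_of_mem (show r ∈ Set.Iio R from hrR)]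
      have hmem (θ : ℝ) : (r * Complex.exp (θ * Complex.I) : ℂ) ∈ Metric.ball (0 : ℂ) R := by
        rw [mem_ball_zero_iff, hnorm]
        exact hrR
      simp only [G, Set.indicator_of_mem (hmem _), hnorm, K]
      rw [lintegral_const_mul' _ _ (by simp), lintegral_const_mul' _ _ (by simp), mul_assoc]
    · rw [Set.indicator_of_notMem (show r ∉ Set.Iio R from hrR)]
      have hmem (θ : ℝ) : (r * Complex.exp (θ * Complex.I) : ℂ) ∉ Metric.ball (0 : ℂ) R := by
        rw [mem_ball_zero_iff, hnorm]
        exact hrR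
      simp [G, Set.indicator_of_notMem (hmem _)]
  · have hm : Measurable fun p : ℝ × ℝ => Complex.polarCoord.symm p := by
      simp only [Complex.polarCoord_symm_apply]
      fun_prop
    exact ((ENNReal.measurable_ofReal.comp measurable_fst).mul (hG.comp hm)).aemeasurable

/-- The norm of the weighted `L²` space on a slice, in terms of power series coefficients. -/
theorem lintegral_discMeasure_of_hasSum {α R : ℝ} (hα : 0 < α) (hR : 0 < R) {f : ℍ[ℝ] → ℍ[ℝ]}
    {a : ℕ → ℍ[ℝ]} (hf : ∀ q ∈ qBall R, HasSum (fun n => q ^ n * a n) (f q))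
    (J : ℍ[ℝ]) (hJ : J * J = -1) :
    ∫⁻ z, ‖f (sliceEmb J hJ z)‖ₑ ^ 2 ∂(discMeasure α R) =
      ∑' n, ENNReal.ofReal (R ^ (2 * n) / binomCoef (α + 1) n) * ‖a n‖ₑ ^ 2 := by
  have hcont : ContinuousOn (fun z => ‖f (sliceEmb J hJ z)‖ₑ ^ 2) (Metric.ball (0 : ℂ) R) := by
    have h := (analyticOnNhd_of_hasSum hR hf).continuousOn.comp
      (continuous_sliceEmb J hJ).continuousOn (fun z hz => sliceEmb_mem_qBall.mpr hz)
    exact (ENNReal.continuous_pow 2).comp_continuousOn h.enorm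
  rw [lintegral_discMeasure_polar α hcont]
  -- Each weight is written back as a radial integral; after exchanging sum and integral it remains
  -- to compare integrands at a fixed radius, which is Parseval.
  simp only [← lintegral_radial hα hR]
  have hmeas (n : ℕ) : Measurable fun r : ℝ => ENNReal.ofReal (r * (α / (Real.pi * R ^ 2) *
      (1 - r ^ 2 / R ^ 2) ^ (α - 1)) * (2 * Real.pi * r ^ (2 * n))) := by fun_prop
  simp only [← lintegral_mul_const _ (hmeas _)]
  rw [← lintegral_tsum fun n => ((hmeas n).mul_const _).aemeasurable]
  refine setLIntegral_congr_fun measurableSet_Ioo fun r hr => ?_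
  have hr0 : 0 < r := hr.1
  have hexp (θ : ℝ) : f (sliceEmb J hJ (r * Complex.exp (θ * Complex.I))) =
      ∑' n : ℕ, sliceEmb J hJ (Complex.exp (n * Complex.I * θ)) * ((r ^ n : ℝ) • a n) := by
    have hmem : sliceEmb J hJ (r * Complex.exp (θ * Complex.I)) ∈ qBall R := by
      rw [sliceEmb_mem_qBall, mem_ball_zero_iff, norm_mul, Complex.norm_exp_ofReal_mul_I, mul_one,
        Complex.norm_real, Real.norm_of_nonneg hr0.le]
      exact hr.2
    rw [← (hf _ hmem).tsum_eq]
    refine tsum_congr fun n => ?_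
    rw [← map_pow, mul_pow, ← Complex.exp_nat_mul, ← Complex.ofReal_pow, map_mul, sliceEmb_ofReal,
      Quaternion.coe_mul_eq_smul, smul_mul_assoc, mul_smul_comm, ← mul_assoc,
      mul_right_comm (n : ℂ)]
  have hsum : Summable fun n => ‖(r ^ n : ℝ) • a n‖ := by
    refine (summable_norm_of_hasSum_qBall hf hr0.le hr.2).congr fun n => ?_
    rw [norm_smul, Real.norm_of_nonneg (by positivity)]
  have h0 : 0 ≤ r * (α / (Real.pi * R ^ 2) * (1 - r ^ 2 / R ^ 2) ^ (α - 1)) := by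
    have : 0 ≤ 1 - r ^ 2 / R ^ 2 := by
      rw [sub_nonneg, div_le_one (by positivity)]
      have := hr.2
      gcongr
    positivity
  simp only [hexp]
  rw [lintegral_circle J hJ hsum, ← ENNReal.ofReal_mul hr0.le, ← ENNReal.tsum_mul_left]
  refine tsum_congr fun n => ?_
  rw [enorm_sq_eq_ofReal, enorm_sq_eq_ofReal, norm_smul, Real.norm_of_nonneg (by positivity),
    ← ENNReal.ofReal_mul (by positivity), ← ENNReal.ofReal_mul h0,
    ← ENNReal.ofReal_mul (mul_nonneg h0 (by positivity))]
  congr 1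
  rw [mul_pow, ← pow_mul, mul_comm n 2]
  ring

/-! ### Laguerre functions as an orthonormal basis -/

theorem quaternion_inner_eq (a b : ℍ[ℝ]) : inner ℝ a b = (star a * b).re := by
  rw [Quaternion.inner_def, quaternion_re_mul_comm, ← Quaternion.re_star, star_mul, star_star]

/-- The normalization constant of the Laguerre functions. -/
noncomputable def laguerreNorm (α : ℝ) (n : ℕ) : ℝ := Real.sqrt (binomCoef (α + 1) n)⁻¹

theorem laguerreNorm_pos {α : ℝ} (hα : 0 < α) (n : ℕ) : 0 < laguerreNorm α n :=
  Real.sqrt_pos.mpr (inv_pos.mpr (binomCoef_pos (by positivity) n))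

theorem laguerreNorm_sq {α : ℝ} (hα : 0 < α) (n : ℕ) :
    laguerreNorm α n ^ 2 = (binomCoef (α + 1) n)⁻¹ :=
  Real.sq_sqrt (inv_nonneg.mpr (binomCoef_pos (by positivity) n).le)

theorem laguerreBasis_eq (α : ℝ) (n : ℕ) (t : ℝ) :
    laguerreBasis α n t = ((laguerreNorm α n * laguerre α n t : ℝ) : ℍ[ℝ]) := by
  rw [laguerreBasis, laguerreNorm, binomCoef, inv_div, Real.Gamma_nat_eq_factorial,
    show α + 1 + n = α + n + 1 by ring]

theorem memLp_laguerreBasis {α : ℝ} (hα : 0 < α) (n : ℕ) :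
    MemLp (laguerreBasis α n) 2 (laguerreMeasure α) := by
  refine ((memLp_laguerre hα n).const_mul (laguerreNorm α n)).of_le ?_ ?_
  · simp only [funext (laguerreBasis_eq α n)]
    exact (Quaternion.continuous_coe.comp
      (continuous_const.mul (continuous_laguerre α n))).aestronglyMeasurable
  · filter_upwards with t
    rw [laguerreBasis_eq, Quaternion.norm_coe]

/-- The normalized Laguerre functions as elements of the weighted `L²` space. -/
noncomputable def laguerreFun {α : ℝ} (hα : 0 < α) (n : ℕ) : laguerreL2 α :=
  (memLp_laguerreBasis hα n).toLp _

theorem coeFn_laguerreFun {α : ℝ} (hα : 0 < α) (n : ℕ) :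
    laguerreFun hα n =ᵐ[laguerreMeasure α] laguerreBasis α n :=
  MemLp.coeFn_toLp _

theorem coeFn_op_smul_laguerreFun {α : ℝ} (hα : 0 < α) (n : ℕ) (c : ℍ[ℝ]) :
    (MulOpposite.op c • laguerreFun hα n : laguerreL2 α) =ᵐ[laguerreMeasure α]
      fun t => (laguerreNorm α n * laguerre α n t) • c := by
  filter_upwards [Lp.coeFn_smul (MulOpposite.op c) (laguerreFun hα n), coeFn_laguerreFun hα n]
    with t h1 h2
  rw [h1, Pi.smul_apply, h2, op_smul_eq_mul, laguerreBasis_eq,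
    Quaternion.coe_mul_eq_smul]

theorem integrable_laguerre_smul_Lp {α : ℝ} (hα : 0 < α) (φ : laguerreL2 α) (n : ℕ) :
    Integrable (fun t => laguerre α n t • φ t) (laguerreMeasure α) :=
  integrable_laguerre_smul hα (Lp.memLp φ) n

/-- Real scalar products with all `φₙ c` determine the quaternionic coefficient, so real Hilbert
space theory suffices. -/
theorem inner_op_smul_laguerreFun {α : ℝ} (hα : 0 < α) (n : ℕ) (c : ℍ[ℝ]) (φ : laguerreL2 α) :
    inner ℝ (MulOpposite.op c • laguerreFun hα n) φ =
      inner ℝ c (laguerreNorm α n • laguerreCoef α φ n) := by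
  rw [L2.inner_def, laguerreCoef, ← integral_smul, ← integral_inner
    (f := fun t => laguerreNorm α n • laguerre α n t • φ t) ((integrable_laguerre_smul_Lp hα φ n).smul (laguerreNorm α n))]
  refine integral_congr_ae ?_
  filter_upwards [coeFn_op_smul_laguerreFun hα n c] with t ht
  rw [ht, smul_smul, real_inner_smul_left, real_inner_smul_right]

theorem laguerreCoef_op_smul_laguerreFun {α : ℝ} (hα : 0 < α) (m n : ℕ) (c : ℍ[ℝ]) :
    laguerreCoef α (MulOpposite.op c • laguerreFun hα n : laguerreL2 α) m =
      if m = n then (laguerreNorm α n)⁻¹ • c else 0 := by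
  have h : laguerreCoef α (MulOpposite.op c • laguerreFun hα n : laguerreL2 α) m =
      (laguerreNorm α n * ∫ t, laguerre α m t * laguerre α n t ∂(laguerreMeasure α)) • c := by
    rw [laguerreCoef, ← integral_const_mul, ← integral_smul_const]
    refine integral_congr_ae ?_
    filter_upwards [coeFn_op_smul_laguerreFun hα n c] with t ht
    rw [ht, smul_smul, mul_left_comm]
  rw [h, integral_laguerre_mul_laguerre hα]
  split_ifs with hmn
  · congr 1
    have h1 := laguerreNorm_sq hα n
    have h2 := (laguerreNorm_pos hα n).ne'
    have h3 := (binomCoef_pos (show 0 < α + 1 by positivity) n).ne'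
    field_simp at h1 ⊢
    linarith
  · simp

/-- The isometric embedding `c ↦ φ_n c`. -/
noncomputable def laguerreEmb {α : ℝ} (hα : 0 < α) (n : ℕ) : ℍ[ℝ] →ₗᵢ[ℝ] laguerreL2 α where
  toFun c := MulOpposite.op c • laguerreFun hα n
  map_add' c d := by rw [MulOpposite.op_add, add_smul]
  map_smul' r c := by rw [MulOpposite.op_smul, smul_assoc, RingHom.id_apply]
  norm_map' c := by
    change ‖MulOpposite.op c • laguerreFun hα n‖ = ‖c‖
    rw [← pow_left_inj₀ (norm_nonneg _) (norm_nonneg _) two_ne_zero,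
      ← real_inner_self_eq_norm_sq, ← real_inner_self_eq_norm_sq, inner_op_smul_laguerreFun,
      laguerreCoef_op_smul_laguerreFun, if_pos rfl, smul_inv_smul₀ (laguerreNorm_pos hα n).ne']

theorem laguerreEmb_apply {α : ℝ} (hα : 0 < α) (n : ℕ) (c : ℍ[ℝ]) :
    laguerreEmb hα n c = MulOpposite.op c • laguerreFun hα n := rfl

/-- Pairing `φ` with each constant quaternion reduces the claim to completeness for real-valued
functions. -/
theorem eq_zero_of_laguerreCoef_eq_zero {α : ℝ} (hα : 0 < α) {φ : laguerreL2 α}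
    (h : ∀ n, laguerreCoef α φ n = 0) : φ = 0 := by
  rw [Lp.eq_zero_iff_ae_eq_zero]
  refine ae_eq_zero_of_forall_inner (𝕜 := ℝ) fun c => ?_
  refine ae_eq_zero_of_laguerreCoef_eq_zero hα ((Lp.memLp φ).const_inner c) fun n => ?_
  have e := integral_inner (𝕜 := ℝ) (integrable_laguerre_smul_Lp hα φ n) c
  rw [← laguerreCoef, h n, inner_zero_right] at e
  rw [← e]
  simp only [real_inner_smul_right, smul_eq_mul]

theorem iSup_range_laguerreEmb {α : ℝ} (hα : 0 < α) :
    (⨆ n, LinearMap.range (laguerreEmb hα n).toLinearMap).topologicalClosure = ⊤ := by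
  rw [Submodule.topologicalClosure_eq_top_iff, Submodule.eq_bot_iff]
  intro φ hφ
  refine eq_zero_of_laguerreCoef_eq_zero hα fun n => ?_
  have h : ∀ c : ℍ[ℝ], inner ℝ c (laguerreNorm α n • laguerreCoef α φ n) = 0 := fun c => by
    rw [← inner_op_smul_laguerreFun hα]
    exact (Submodule.mem_orthogonal _ _).mp hφ _
      (Submodule.mem_iSup_of_mem n ⟨c, rfl⟩)
  have h2 := inner_self_eq_zero.mp (h _)
  exact (smul_eq_zero.mp h2).resolve_left (laguerreNorm_pos hα n).ne'

/-- Over `ℝ`, the quaternionic lines `φₙ ℍ` are mutually orthogonal copies of `ℍ` with dense sum. -/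
theorem isHilbertSum_laguerreEmb {α : ℝ} (hα : 0 < α) :
    IsHilbertSum ℝ (fun _ : ℕ => ℍ[ℝ]) (laguerreEmb hα) := by
  refine IsHilbertSum.mk (fun m n hmn c d => ?_) (iSup_range_laguerreEmb hα).ge
  rw [laguerreEmb_apply, laguerreEmb_apply, inner_op_smul_laguerreFun,
    laguerreCoef_op_smul_laguerreFun, if_neg hmn, smul_zero, inner_zero_right]

/-- The coordinates of an element of the weighted `L²` space in the basis of Laguerre functions. -/
noncomputable def laguerreCoordinates {α : ℝ} (hα : 0 < α) :
    laguerreL2 α ≃ₗᵢ[ℝ] lp (fun _ : ℕ => ℍ[ℝ]) 2 :=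
  (isHilbertSum_laguerreEmb hα).linearIsometryEquiv

theorem laguerreCoordinates_apply {α : ℝ} (hα : 0 < α) (φ : laguerreL2 α) (n : ℕ) :
    laguerreCoordinates hα φ n = laguerreNorm α n • laguerreCoef α φ n := by
  refine ext_inner_left ℝ fun c => ?_
  rw [← inner_op_smul_laguerreFun hα, ← laguerreEmb_apply,
    ← (isHilbertSum_laguerreEmb hα).linearIsometryEquiv_symm_apply_single,
    ← lp.inner_single_left (𝕜 := ℝ) (G := fun _ : ℕ => ℍ[ℝ]),
    ← (laguerreCoordinates hα).inner_map_map]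
  congr 1
  exact ((laguerreCoordinates hα).apply_symm_apply _).symm

theorem hasSum_norm_sq_laguerreCoef {α : ℝ} (hα : 0 < α) (φ : laguerreL2 α) :
    HasSum (fun n => ‖laguerreNorm α n • laguerreCoef α φ n‖ ^ 2) (‖φ‖ ^ 2) := by
  have h := lp.hasSum_norm (p := 2) (by norm_num) (laguerreCoordinates hα φ)
  rw [(laguerreCoordinates hα).norm_map] at h
  simpa [laguerreCoordinates_apply] using h

theorem zeroExt_of_mem {R : ℝ} (f : qBall R → ℍ[ℝ]) {q : ℍ[ℝ]} (hq : q ∈ qBall R) :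
    zeroExt f q = f ⟨q, hq⟩ := dif_pos hq

theorem discFun_eq {R : ℝ} (I : ℍ[ℝ]) (hI : I * I = -1) (f : qBall R → ℍ[ℝ]) (z : ℂ) :
    discFun I f z = zeroExt f (sliceEmb I hI z) := by
  rw [discFun, sliceEmb_eq_slicePt]

/-! ### The Bergman space as a weighted sequence space -/

section Bergman

variable {α R : ℝ} {I : ℍ[ℝ]} {f : qBall R → ℍ[ℝ]} {c : ℕ → ℍ[ℝ]}

theorem ofReal_mul_enorm_sq_eq (hα : 0 < α) (hR : 0 < R) (a : ℍ[ℝ]) (n : ℕ) :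
    ENNReal.ofReal (R ^ (2 * n) / binomCoef (α + 1) n) * ‖(R⁻¹ ^ n : ℝ) • a‖ₑ ^ 2 =
      ENNReal.ofReal (‖laguerreNorm α n • a‖ ^ 2) := by
  have := binomCoef_pos (show 0 < α + 1 by positivity) n
  rw [enorm_sq_eq_ofReal, ← ENNReal.ofReal_mul (by positivity), norm_smul, norm_smul, mul_pow,
    mul_pow, Real.norm_eq_abs, Real.norm_eq_abs, sq_abs, sq_abs, laguerreNorm_sq hα]
  have h : R ^ (2 * n) * (R⁻¹ ^ n) ^ 2 = 1 := by
    rw [← pow_mul, mul_comm n 2, ← mul_pow, mul_inv_cancel₀ hR.ne', one_pow]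
  congr 1
  rw [div_eq_mul_inv]
  linear_combination (binomCoef (α + 1) n)⁻¹ * ‖a‖ ^ 2 * h

theorem hasSum_pow_mul_iff {q F : ℍ[ℝ]} :
    HasSum (fun n => (q / (R : ℍ[ℝ])) ^ n * c n) F ↔
      HasSum (fun n => q ^ n * ((R⁻¹ ^ n : ℝ) • c n)) F := by
  have e (n : ℕ) : (q / (R : ℍ[ℝ])) ^ n * c n = q ^ n * ((R⁻¹ ^ n : ℝ) • c n) := by
    rw [div_eq_mul_inv, ← Quaternion.coe_inv, Quaternion.mul_coe_eq_smul, smul_pow, smul_mul_assoc,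
      mul_smul_comm]
  simp only [e]

/-- The right-hand side is the sum that computes the norm in the Laguerre `L²` space, and does not
involve `I`. -/
theorem lintegral_discFun (hα : 0 < α) (hR : 0 < R) (hI : I * I = -1)
    (hf : ∀ q ∈ qBall R, HasSum (fun n => (q / (R : ℍ[ℝ])) ^ n * c n) (zeroExt f q)) :
    ∫⁻ z, ‖discFun I f z‖ₑ ^ 2 ∂(discMeasure α R) =
      ∑' n, ENNReal.ofReal (‖laguerreNorm α n • c n‖ ^ 2) := by
  simp only [discFun_eq I hI]
  rw [lintegral_discMeasure_of_hasSum hα hR (fun q hq => (hasSum_pow_mul_iff).mp (hf q hq))]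
  exact tsum_congr fun n => ofReal_mul_enorm_sq_eq hα hR _ n

theorem aestronglyMeasurable_discFun (hR : 0 < R) (hI : I * I = -1)
    (hf : ∀ q ∈ qBall R, HasSum (fun n => (q / (R : ℍ[ℝ])) ^ n * c n) (zeroExt f q)) :
    AEStronglyMeasurable (discFun I f) (discMeasure α R) := by
  have h := (analyticOnNhd_of_hasSum hR
    (fun q hq => (hasSum_pow_mul_iff).mp (hf q hq))).continuousOn.comp
    (continuous_sliceEmb I hI).continuousOn (fun z hz => sliceEmb_mem_qBall.mpr hz)
  have h2 := h.aestronglyMeasurable (μ := volume) Metric.isOpen_ball.measurableSet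
  rw [funext (discFun_eq I hI f)]
  exact h2.mono_ac (withDensity_absolutelyContinuous _ _)

theorem mem_bergmanSpace_of_hasSum (hα : 0 < α) (hR : 0 < R) (hI : I * I = -1)
    (hf : ∀ q ∈ qBall R, HasSum (fun n => (q / (R : ℍ[ℝ])) ^ n * c n) (zeroExt f q))
    (hc : Summable fun n => ‖laguerreNorm α n • c n‖ ^ 2) : f ∈ bergmanSpace α R I := by
  refine ⟨isSliceRegularOn_of_hasSum hR fun q hq => (hasSum_pow_mul_iff).mp (hf q hq),
    aestronglyMeasurable_discFun hR hI hf, ?_⟩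
  rw [eLpNorm_lt_top_iff_lintegral_rpow_enorm_lt_top two_ne_zero ENNReal.ofNat_ne_top]
  simp only [ENNReal.toReal_ofNat, ENNReal.rpow_ofNat]
  rw [lintegral_discFun hα hR hI hf, ← ENNReal.ofReal_tsum_of_nonneg (fun n => by positivity) hc]
  exact ENNReal.ofReal_lt_top

theorem integral_norm_sq_discFun (hα : 0 < α) (hR : 0 < R) (hI : I * I = -1)
    (hf : ∀ q ∈ qBall R, HasSum (fun n => (q / (R : ℍ[ℝ])) ^ n * c n) (zeroExt f q)) {s : ℝ}
    (hc : HasSum (fun n => ‖laguerreNorm α n • c n‖ ^ 2) s) :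
    ∫ z, ‖discFun I f z‖ ^ 2 ∂(discMeasure α R) = s := by
  have hm : AEStronglyMeasurable (fun z => ‖discFun I f z‖ ^ 2) (discMeasure α R) :=
    (aestronglyMeasurable_discFun hR hI hf).norm.pow 2
  rw [integral_eq_lintegral_of_nonneg_ae (by filter_upwards with z; positivity) hm]
  simp only [← enorm_sq_eq_ofReal]
  rw [lintegral_discFun hα hR hI hf,
    ← ENNReal.ofReal_tsum_of_nonneg (fun n => by positivity) hc.summable, hc.tsum_eq,
    ENNReal.toReal_ofReal (hc.nonneg fun n => by positivity)]

theorem exists_hasSum_of_mem_bergmanSpace (hα : 0 < α) (hR : 0 < R) (hI : I * I = -1)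
    (hf : f ∈ bergmanSpace α R I) : ∃ c : ℕ → ℍ[ℝ],
      (∀ q ∈ qBall R, HasSum (fun n => (q / (R : ℍ[ℝ])) ^ n * c n) (zeroExt f q)) ∧
      Summable fun n => ‖laguerreNorm α n • c n‖ ^ 2 := by
  obtain ⟨a, ha⟩ := hf.1.exists_hasSum hR
  have hs : ∀ q ∈ qBall R,
      HasSum (fun n => (q / (R : ℍ[ℝ])) ^ n * ((R ^ n : ℝ) • a n)) (zeroExt f q) := by
    intro q hq
    rw [hasSum_pow_mul_iff]
    refine (ha q hq).congr_fun fun n => ?_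
    rw [smul_smul, ← mul_pow, inv_mul_cancel₀ hR.ne', one_pow, one_smul]
  refine ⟨_, hs, ?_⟩
  -- The norm identity holds in `ℝ≥0∞` without assumption, so square integrability becomes
  -- summability of the coefficients.
  have h := (eLpNorm_lt_top_iff_lintegral_rpow_enorm_lt_top two_ne_zero
    ENNReal.ofNat_ne_top).mp hf.2.2
  simp only [ENNReal.toReal_ofNat, ENNReal.rpow_ofNat] at h
  rw [lintegral_discFun hα hR hI hs] at h
  refine (ENNReal.summable_toReal h.ne).congr fun n => ?_
  rw [ENNReal.toReal_ofReal (by positivity)]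

end Bergman

/-! ### Linearity and bijectivity of the transform -/

section Transform

variable {α R : ℝ} {I : ℍ[ℝ]}

theorem hasSum_zeroExt_bargmann (hα : 0 < α) (hR : 0 < R) (φ : laguerreL2 α) :
    ∀ q ∈ qBall R, HasSum (fun n => (q / (R : ℍ[ℝ])) ^ n * laguerreCoef α φ n)
      (zeroExt (fun q : qBall R => bargmann α R φ q) q) := by
  intro q hq
  rw [zeroExt_of_mem _ hq]
  exact hasSum_bargmann hα hR (Lp.memLp φ) hq

theorem bargmann_add (hα : 0 < α) (hR : 0 < R) (φ ψ : laguerreL2 α) {q : ℍ[ℝ]}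
    (hq : q ∈ qBall R) :
    bargmann α R (φ + ψ : laguerreL2 α) q = bargmann α R φ q + bargmann α R ψ q := by
  unfold bargmann
  rw [← mul_add, ← integral_add (integrable_bargmann_integrand hα hR (Lp.memLp φ) hq)
    (integrable_bargmann_integrand hα hR (Lp.memLp ψ) hq)]
  congr 1
  refine integral_congr_ae ?_
  filter_upwards [Lp.coeFn_add φ ψ] with t ht
  rw [ht, Pi.add_apply, mul_add]

theorem bargmann_smul (hα : 0 < α) (hR : 0 < R) (c : ℍ[ℝ]ᵐᵒᵖ) (φ : laguerreL2 α) {q : ℍ[ℝ]}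
    (hq : q ∈ qBall R) :
    bargmann α R (c • φ : laguerreL2 α) q = c • bargmann α R φ q := by
  unfold bargmann
  rw [MulOpposite.smul_eq_mul_unop, mul_assoc, ← integral_mul_const_of_integrable
    (integrable_bargmann_integrand hα hR (Lp.memLp φ) hq)]
  congr 1
  refine integral_congr_ae ?_
  filter_upwards [Lp.coeFn_smul c φ] with t ht
  rw [ht, Pi.smul_apply, MulOpposite.smul_eq_mul_unop, mul_assoc]

/-- The transform as a right linear map into the slice Bergman space. -/
noncomputable def bargmannLinear (hα : 0 < α) (hR : 0 < R) (hI : I * I = -1) :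
    laguerreL2 α →ₗ[ℍ[ℝ]ᵐᵒᵖ] bergmanSpace α R I where
  toFun φ := ⟨fun q => bargmann α R φ q, mem_bergmanSpace_of_hasSum hα hR hI
    (hasSum_zeroExt_bargmann hα hR φ) (hasSum_norm_sq_laguerreCoef hα φ).summable⟩
  map_add' φ ψ := Subtype.ext (funext fun q => bargmann_add hα hR φ ψ q.2)
  map_smul' c φ := Subtype.ext (funext fun q => bargmann_smul hα hR c φ q.2)

theorem integral_norm_sq_bargmannLinear (hα : 0 < α) (hR : 0 < R) (hI : I * I = -1)
    (φ : laguerreL2 α) :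
    ∫ z, ‖discFun I (bargmannLinear hα hR hI φ : qBall R → ℍ[ℝ]) z‖ ^ 2 ∂(discMeasure α R) =
      ‖φ‖ ^ 2 :=
  integral_norm_sq_discFun hα hR hI (hasSum_zeroExt_bargmann hα hR φ)
    (hasSum_norm_sq_laguerreCoef hα φ)

theorem bergmanNorm_bargmannLinear (hα : 0 < α) (hR : 0 < R) (hI : I * I = -1)
    (φ : laguerreL2 α) :
    bergmanNorm α I (bargmannLinear hα hR hI φ : qBall R → ℍ[ℝ]) = ‖φ‖ := by
  rw [bergmanNorm, integral_norm_sq_bargmannLinear, Real.sqrt_sq (norm_nonneg φ)]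

theorem bargmannLinear_bijective (hα : 0 < α) (hR : 0 < R) (hI : I * I = -1) :
    Function.Bijective (bargmannLinear hα hR hI) := by
  constructor
  · rw [injective_iff_map_eq_zero]
    intro φ h
    rw [← norm_eq_zero, ← bergmanNorm_bargmannLinear hα hR hI, h, ZeroMemClass.coe_zero]
    simp [bergmanNorm, discFun, zeroExt_zero]
  · rintro ⟨f, hf⟩
    obtain ⟨c, hc, hs⟩ := exists_hasSum_of_mem_bergmanSpace hα hR hI hf
    have hmem : Memℓp (E := fun _ : ℕ => ℍ[ℝ]) (fun n => laguerreNorm α n • c n) 2 := by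
      rw [memℓp_gen_iff (by norm_num)]
      simpa using hs
    -- The preimage is the element with these Laguerre coordinates: its transform has the power
    -- series coefficients of `f`.
    let w : lp (fun _ : ℕ => ℍ[ℝ]) 2 := ⟨fun n => laguerreNorm α n • c n, hmem⟩
    refine ⟨(laguerreCoordinates hα).symm w, Subtype.ext (funext fun q => ?_)⟩
    have hcoef (n : ℕ) : laguerreCoef α ((laguerreCoordinates hα).symm w) n = c n := by
      have h := laguerreCoordinates_apply hα ((laguerreCoordinates hα).symm w) n
      rw [LinearIsometryEquiv.apply_symm_apply] at h
      exact (smul_right_injective _ (laguerreNorm_pos hα n).ne' h).symm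
    have h1 := hasSum_zeroExt_bargmann hα hR ((laguerreCoordinates hα).symm w) q q.2
    simp only [hcoef] at h1
    have h2 := h1.unique (hc q q.2)
    rwa [zeroExt_of_mem _ q.2, zeroExt_of_mem _ q.2] at h2

/-- The transform as a right linear equivalence with the slice Bergman space. -/
noncomputable def bargmannEquiv (hα : 0 < α) (hR : 0 < R) (hI : I * I = -1) :
    laguerreL2 α ≃ₗ[ℍ[ℝ]ᵐᵒᵖ] bergmanSpace α R I :=
  LinearEquiv.ofBijective (bargmannLinear hα hR hI) (bargmannLinear_bijective hα hR hI)

end Transform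

/-! ### Scalar products by polarization, and bases -/

section Polarization

variable {X Y : Type*} [MeasurableSpace X] [MeasurableSpace Y] {μ : Measure X} {ν : Measure Y}

/-- Real polarization of `F` and `G c`; a quaternionic `c` gives access to every component of the
scalar product. -/
theorem re_integral_star_mul {F G : X → ℍ[ℝ]} (hF : MemLp F 2 μ) (hG : MemLp G 2 μ) (c : ℍ[ℝ]) :
    4 * ((∫ x, star (F x) * G x ∂μ) * c).re =
      (∫ x, ‖F x + G x * c‖ ^ 2 ∂μ) - ∫ x, ‖F x + G x * (-c)‖ ^ 2 ∂μ := by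
  have hFG : Integrable (fun x => star (F x) * G x) μ := hF.star.integrable_mul hG
  have hi (d : ℍ[ℝ]) : Integrable (fun x => ‖F x + G x * d‖ ^ 2) μ := by
    have h : MemLp (fun x => F x + G x * d) 2 μ := hF.add (hG.mul_const d)
    exact_mod_cast h.integrable_norm_pow two_ne_zero
  rw [← integral_sub (hi c) (hi (-c)), ← integral_mul_const_of_integrable hFG, ← reCLM_apply,
    ← reCLM.integral_comp_comm (hFG.mul_const c), ← integral_const_mul]
  refine integral_congr_ae ?_
  filter_upwards with x
  rw [mul_neg, norm_add_sq_real, norm_add_sq_real, inner_neg_right, norm_neg, reCLM_apply,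
    mul_assoc, ← quaternion_inner_eq]
  ring

theorem integral_star_mul_eq_of_norm_eq {F G : X → ℍ[ℝ]} {F' G' : Y → ℍ[ℝ]} (hF : MemLp F 2 μ)
    (hG : MemLp G 2 μ) (hF' : MemLp F' 2 ν) (hG' : MemLp G' 2 ν)
    (h : ∀ c : ℍ[ℝ], ∫ x, ‖F x + G x * c‖ ^ 2 ∂μ = ∫ y, ‖F' y + G' y * c‖ ^ 2 ∂ν) :
    ∫ x, star (F x) * G x ∂μ = ∫ y, star (F' y) * G' y ∂ν := by
  rw [← sub_eq_zero, ← norm_eq_zero, ← sq_eq_zero_iff, norm_sq_eq_re_mul_star, sub_mul,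
    Quaternion.re_sub]
  -- With `c` the conjugate of the difference `D` of the two scalar products, `Re(D c) = |D|²`, so
  -- equality of the real parts already forces `D = 0`.
  set c := star ((∫ x, star (F x) * G x ∂μ) - ∫ y, star (F' y) * G' y ∂ν)
  have h1 := re_integral_star_mul hF hG c
  have h2 := re_integral_star_mul hF' hG' c
  rw [h, h] at h1
  linarith

end Polarization

theorem norm_sq_eq_integral {α : ℝ} (φ : laguerreL2 α) :
    ‖φ‖ ^ 2 = ∫ t, ‖φ t‖ ^ 2 ∂(laguerreMeasure α) := by
  rw [← real_inner_self_eq_norm_sq, L2.inner_def]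
  simp only [real_inner_self_eq_norm_sq]

/-- By right linearity, norm preservation at `φ + ψ c` is the hypothesis of the polarization lemma.
-/
theorem bergmanInner_bargmannLinear {α R : ℝ} {I : ℍ[ℝ]} (hα : 0 < α) (hR : 0 < R)
    (hI : I * I = -1) (φ ψ : laguerreL2 α) :
    bergmanInner α I (bargmannLinear hα hR hI φ : qBall R → ℍ[ℝ])
      (bargmannLinear hα hR hI ψ : qBall R → ℍ[ℝ]) = laguerreInner α φ ψ := by
  unfold bergmanInner laguerreInner
  refine integral_star_mul_eq_of_norm_eq (bargmannLinear hα hR hI φ).2.2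
    (bargmannLinear hα hR hI ψ).2.2 (Lp.memLp φ) (Lp.memLp ψ) fun c => ?_
  have h := integral_norm_sq_bargmannLinear hα hR hI (φ + MulOpposite.op c • ψ)
  have e (z : ℂ) : discFun I
      (bargmannLinear hα hR hI (φ + MulOpposite.op c • ψ) : qBall R → ℍ[ℝ]) z =
      discFun I (bargmannLinear hα hR hI φ : qBall R → ℍ[ℝ]) z +
        discFun I (bargmannLinear hα hR hI ψ : qBall R → ℍ[ℝ]) z * c := by
    rw [map_add, map_smul, Submodule.coe_add, Submodule.coe_smul, discFun, zeroExt_add,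
      zeroExt_smul]
    rfl
  simp only [e] at h
  rw [h, norm_sq_eq_integral]
  refine integral_congr_ae ?_
  filter_upwards [Lp.coeFn_add φ (MulOpposite.op c • ψ), Lp.coeFn_smul (MulOpposite.op c) ψ]
    with t h1 h2
  rw [h1, Pi.add_apply, h2, Pi.smul_apply, op_smul_eq_mul]

/-- By orthogonality only the `n`-th coefficient of `φₙ` is nonzero, and it equals `√bₙ`. -/
theorem bargmannLinear_laguerreFun {α R : ℝ} {I : ℍ[ℝ]} (hα : 0 < α) (hR : 0 < R)
    (hI : I * I = -1) (n : ℕ) :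
    (bargmannLinear hα hR hI (laguerreFun hα n) : qBall R → ℍ[ℝ]) = monomialBasis α R n := by
  funext q
  have h := hasSum_zeroExt_bargmann hα hR (laguerreFun hα n) q q.2
  have hc (m : ℕ) := laguerreCoef_op_smul_laguerreFun hα m n 1
  simp only [MulOpposite.op_one, one_smul] at hc
  have h2 := h.unique (hasSum_single n fun m hm => by rw [hc, if_neg hm, mul_zero])
  rw [zeroExt_of_mem _ q.2, hc, if_pos rfl] at h2
  refine h2.trans ?_
  rw [monomialBasis, mul_smul_comm, mul_one, ← Quaternion.coe_mul_eq_smul, laguerreNorm,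
    ← Real.sqrt_inv, inv_inv, binomCoef, show α + 1 + n = n + α + 1 by ring]

theorem laguerreInner_laguerreFun {α : ℝ} (hα : 0 < α) (m n : ℕ) :
    laguerreInner α (laguerreFun hα m) (laguerreFun hα n) = if m = n then 1 else 0 := by
  have h : laguerreInner α (laguerreFun hα m) (laguerreFun hα n) =
      laguerreNorm α m • laguerreCoef α (laguerreFun hα n) m := by
    rw [laguerreInner, laguerreCoef, ← integral_smul]
    refine integral_congr_ae ?_
    filter_upwards [coeFn_laguerreFun hα m] with t ht
    rw [ht, laguerreBasis_eq, Quaternion.star_coe, Quaternion.coe_mul_eq_smul, mul_smul]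
  have hc := laguerreCoef_op_smul_laguerreFun hα m n 1
  rw [MulOpposite.op_one, one_smul] at hc
  rw [h, hc]
  split_ifs with hmn
  · rw [hmn, smul_inv_smul₀ (laguerreNorm_pos hα n).ne']
  · rw [smul_zero]

theorem dense_span_laguerreFun {α : ℝ} (hα : 0 < α) :
    Dense (Submodule.span ℍ[ℝ]ᵐᵒᵖ (Set.range (laguerreFun hα)) : Set (laguerreL2 α)) := by
  refine (Submodule.dense_iff_topologicalClosure_eq_top.mpr
    (iSup_range_laguerreEmb hα)).mono ?_
  have h : (⨆ n, LinearMap.range (laguerreEmb hα n).toLinearMap) ≤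
      (Submodule.span ℍ[ℝ]ᵐᵒᵖ (Set.range (laguerreFun hα))).restrictScalars ℝ := by
    refine iSup_le fun n => ?_
    rintro _ ⟨c, rfl⟩
    exact Submodule.smul_mem _ (MulOpposite.op c) (Submodule.subset_span (Set.mem_range_self n))
  exact h

end SliceBergman

theorem mainTheorem5 (α R : ℝ) (hα : 0 < α) (hR : 0 < R) :
    -- the integral defining the transform converges absolutely
    (∀ (φ : SliceBergman.laguerreL2 α) (q : ℍ[ℝ]), q ∈ SliceBergman.qBall R →
      Integrable (fun t : ℝ => NormedSpace.exp (t • (q / (q - (R : ℍ[ℝ])))) * φ t)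
        (SliceBergman.laguerreMeasure α)) ∧
    ∀ I : ℍ[ℝ], I * I = -1 →
      -- the transform is a right-linear bijection, preserving norms and scalar products
      ∃ (U : SliceBergman.laguerreL2 α ≃ₗ[ℍ[ℝ]ᵐᵒᵖ] SliceBergman.bergmanSpace α R I)
        (Φ : ℕ → SliceBergman.laguerreL2 α),
        (∀ (φ : SliceBergman.laguerreL2 α) (q : SliceBergman.qBall R),
          (U φ : SliceBergman.qBall R → ℍ[ℝ]) q = SliceBergman.bargmann α R φ q) ∧
        (∀ φ : SliceBergman.laguerreL2 α,
          SliceBergman.bergmanNorm α I (U φ : SliceBergman.qBall R → ℍ[ℝ]) = ‖φ‖) ∧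
        (∀ φ ψ : SliceBergman.laguerreL2 α,
          SliceBergman.bergmanInner α I (U φ : SliceBergman.qBall R → ℍ[ℝ])
            (U ψ : SliceBergman.qBall R → ℍ[ℝ]) = SliceBergman.laguerreInner α φ ψ) ∧
        -- the normalized Laguerre functions are sent to the normalized monomials
        (∀ n : ℕ, Φ n =ᵐ[SliceBergman.laguerreMeasure α] SliceBergman.laguerreBasis α n) ∧
        (∀ n : ℕ, (U (Φ n) : SliceBergman.qBall R → ℍ[ℝ]) = SliceBergman.monomialBasis α R n) ∧
        -- both families are orthonormal bases
        (∀ m n : ℕ, SliceBergman.laguerreInner α (Φ m) (Φ n) = if m = n then 1 else 0) ∧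
        Dense (Submodule.span ℍ[ℝ]ᵐᵒᵖ (Set.range Φ) : Set (SliceBergman.laguerreL2 α)) ∧
        (∀ m n : ℕ, SliceBergman.bergmanInner α I (SliceBergman.monomialBasis α R m)
          (SliceBergman.monomialBasis α R n) = if m = n then 1 else 0) ∧
        (∀ f ∈ SliceBergman.bergmanSpace α R I, ∀ ε : ℝ, 0 < ε →
          ∃ g ∈ Submodule.span ℍ[ℝ]ᵐᵒᵖ (Set.range (SliceBergman.monomialBasis α R)),
            SliceBergman.bergmanNorm α I (f - g) < ε) := by
  refine ⟨fun φ q hq => SliceBergman.integrable_bargmann_integrand hα hR (Lp.memLp φ) hq,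
    fun I hI => ?_⟩
  refine ⟨SliceBergman.bargmannEquiv hα hR hI, SliceBergman.laguerreFun hα, fun φ q => rfl,
    fun φ => SliceBergman.bergmanNorm_bargmannLinear hα hR hI φ,
    fun φ ψ => SliceBergman.bergmanInner_bargmannLinear hα hR hI φ ψ,
    SliceBergman.coeFn_laguerreFun hα, SliceBergman.bargmannLinear_laguerreFun hα hR hI,
    SliceBergman.laguerreInner_laguerreFun hα, SliceBergman.dense_span_laguerreFun hα,
    fun m n => ?_, fun f hf ε hε => ?_⟩
  · rw [← SliceBergman.bargmannLinear_laguerreFun hα hR hI,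
      ← SliceBergman.bargmannLinear_laguerreFun hα hR hI,
      SliceBergman.bergmanInner_bargmannLinear, SliceBergman.laguerreInner_laguerreFun]
  · obtain ⟨φ, hφ⟩ := (SliceBergman.bargmannLinear_bijective hα hR hI).2 ⟨f, hf⟩
    -- Density is carried over by the isometry: approximate the preimage of `f` by combinations of
    -- Laguerre functions, whose images are combinations of monomials.
    obtain ⟨ψ, hψ, hd⟩ := (SliceBergman.dense_span_laguerreFun hα).exists_dist_lt φ hε
    refine ⟨SliceBergman.bargmannLinear hα hR hI ψ, ?_, ?_⟩
    · let T := (SliceBergman.bergmanSpace α R I).subtype ∘ₗ SliceBergman.bargmannLinear hα hR hI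
      have h := Submodule.mem_map_of_mem (f := T) hψ
      rw [Submodule.map_span, ← Set.range_comp] at h
      have e : T ∘ SliceBergman.laguerreFun hα = SliceBergman.monomialBasis α R :=
        funext fun n => SliceBergman.bargmannLinear_laguerreFun hα hR hI n
      rwa [e] at h
    · have e : f - (SliceBergman.bargmannLinear hα hR hI ψ : SliceBergman.qBall R → ℍ[ℝ]) =
          (SliceBergman.bargmannLinear hα hR hI (φ - ψ) : SliceBergman.qBall R → ℍ[ℝ]) := by
        rw [map_sub, hφ, Submodule.coe_sub]
      rw [e, SliceBergman.bergmanNorm_bargmannLinear, ← dist_eq_norm]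
      exact hd
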